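/- **Model.** Running time is measured on a (deterministic) random access machine with logarithmic cost: memory consists of finitely many arrays of natural numbers, and every arithmetic operation, memory access and test costs the bit length of the numbers involved. Up to polylogarithmic factors this is the time on a word RAM with words of $O(\log n)$ bits. **3-OV hypothesis.** Vectors $u,v,w\in\{0,1\}^d$ are orthogonal if for every coordinate $j$ at least one of $u_j,v_j,w_j$ is $0$. The 3-OV problem asks, given three families $A,B,C$ of $n$ vectors in $\{0,1\}^d$ each, whether there are $u\in A$, $v\in B$, $w\in C$ that are orthogonal. The 3-OV hypothesis says that 3-OV in dimension $d=\Theta(\log n)$ requires $n^{3-o(1)}$ time, that is: for every $\varepsilon>0$ there is a constant $c$ such that no algorithm solves 3-OV in dimension $d=c\lceil\log_2 n\rceil$ in time $O(n^{3-\varepsilon})$. **Transformers.** An attention head with embedding dimension $m$ maps $X\in\mathbb{R}^{N\times m}$ to $\mathrm{softmax}(Q(X)K(X)^{\top})V(X)\in\mathbb{R}^{N\times m}$, where $Q,K,V:\mathbb{R}^m\to\mathbb{R}^m$ and the softmax are applied row-wise. A transformer with $L$ layers and $H$ heads per layer and summation aggregation computes $X^{(0)}=X$, $X^{(\ell)}=\Psi_\ell\bigl(X^{(\ell-1)}+\sum_{h=1}^{H}f_{\ell,h}(X^{(\ell-1)})\bigr)$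 for $1\le\ell\le L$, and outputs $\Psi_O(X^{(L)})$, where the $f_{\ell,h}$ are attention heads and the MLPs $\Psi_\ell,\Psi_O$ are continuous maps applied row-wise. It has no MLPs if all $\Psi_\ell$ and $\Psi_O$ are the identity. **Theorem.** Assume the 3-OV hypothesis. Let $m=\Theta(\log N)$ and $L,H=\mathrm{poly}(N)$. Then any algorithm that computes transformers with input length $N$, embedding dimension $m$, $L$ layers, $H$ heads in each layer, and input and output dimension $m$ up to entry-wise additive error $\frac{1}{10N}$ requires $LHN^{2-o(1)}$ time, even if the transformers have no MLPs. Precisely: for every $\varepsilon>0$ and every $k\in\mathbb{N}$ there is a constant $c$ such that the following holds. Let $m,L,H:\mathbb{N}\to\mathbb{N}$ be functions with $m(N)=\Theta(\log N)$, $m(N)\ge c\log_2N$ and $L(N),H(N)\ge1$ for all large $N$, and $L(N),H(N)=O(N^k)$, and suppose that $m(N),L(N),H(N)$ can be computed from $N$ in time $O(N^k)$. Let $b\ge1$ be an integer. Then there is no algorithm that, for all sufficiently large $N$, given any transformer without MLPs with these parameters, whose embeddings $Q,K,V$ are linear maps $x\mapsto xW$ given by weight matrices $W\in\mathbb{Q}^{m(N)\times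 m(N)}$, and any input $X\in\mathbb{Q}^{N\times m(N)}$, where the numerators and denominators of all entries are at most $N^b$ in absolute value, outputs rational approximations of all entries of the transformer's output with additive error at most $\frac{1}{10N}$, in time $O(L(N)H(N)N^{2-\varepsilon})$. -/

import Mathlib

open Filter Asymptotics

/-! ## Random access machines with logarithmic cost

A program works on finitely many arrays (named by numerals in the program text), each an infinite
sequence of cells that hold natural numbers; addresses are computed, so access is random.  Every
arithmetic operation, memory access and test is charged the bit length of the numbers involved.
Up to polylogarithmic factors this is the running time on a word RAM with logarithmic word size. -/

namespace RAM

/-- The contents of the memory: `s a i` is the content of cell `i` of array `a`. -/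
abbrev State : Type := ℕ → ℕ → ℕ

/-- Subtraction is truncated at `0`, division is rounded down, and division by `0` gives `0`. -/
inductive Op : Type
  | add | sub | mul | div

def Op.eval : Op → ℕ → ℕ → ℕ
  | .add, x, y => x + y
  | .sub, x, y => x - y
  | .mul, x, y => x * y
  | .div, x, y => x / y

/-- Expressions; `load a e` reads the cell of array `a` whose address is the value of `e`. -/
inductive Expr : Type
  | lit (n : ℕ)
  | load (a : ℕ) (e : Expr)
  | bin (o : Op) (e₁ e₂ : Expr)

def Expr.eval (s : State) : Expr → ℕ
  | .lit n => n
  | .load a e => s a (e.eval s)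
  | .bin o e₁ e₂ => o.eval (e₁.eval s) (e₂.eval s)

/-- Logarithmic cost of an evaluation: every node is charged one plus the bit length of its value
(so operands, addresses and results are all paid for). -/
def Expr.cost (s : State) : Expr → ℕ
  | .lit n => 1 + n.size
  | .load a e => e.cost s + (1 + (s a (e.eval s)).size)
  | .bin o e₁ e₂ =>
      e₁.cost s + e₂.cost s + (1 + (o.eval (e₁.eval s) (e₂.eval s)).size)

/-- Programs; `store a i e` writes the value of `e` to cell `i` of array `a`, and a test succeeds
when the value of its expression is not `0`. -/
inductive Prog : Type
  | skip
  | store (a : ℕ) (i e : Expr)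
  | seq (p q : Prog)
  | ite (e : Expr) (p q : Prog)
  | loop (e : Expr) (p : Prog)

/-- The memory after writing `v` to cell `i` of array `a`. -/
def State.write (s : State) (a i v : ℕ) : State :=
  fun a' i' => if a' = a ∧ i' = i then v else s a' i'

/-- `Exec p s s' t`: started in `s`, the program `p` halts in `s'` after time `t`. -/
inductive Exec : Prog → State → State → ℕ → Prop
  | skip (s : State) : Exec .skip s s 1
  | store (s : State) (a : ℕ) (i e : Expr) :
      Exec (.store a i e) s (s.write a (i.eval s) (e.eval s)) (i.cost s + e.cost s + 1)
  | seq {p q : Prog} {s s₁ s₂ : State} {t₁ t₂ : ℕ} :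
      Exec p s s₁ t₁ → Exec q s₁ s₂ t₂ → Exec (.seq p q) s s₂ (t₁ + t₂)
  | iteTrue {e : Expr} {p q : Prog} {s s₁ : State} {t : ℕ} :
      e.eval s ≠ 0 → Exec p s s₁ t → Exec (.ite e p q) s s₁ (e.cost s + 1 + t)
  | iteFalse {e : Expr} {p q : Prog} {s s₁ : State} {t : ℕ} :
      e.eval s = 0 → Exec q s s₁ t → Exec (.ite e p q) s s₁ (e.cost s + 1 + t)
  | loopTrue {e : Expr} {p : Prog} {s s₁ s₂ : State} {t₁ t₂ : ℕ} :
      e.eval s ≠ 0 → Exec p s s₁ t₁ → Exec (.loop e p) s₁ s₂ t₂ →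
        Exec (.loop e p) s s₂ (e.cost s + 1 + t₁ + t₂)
  | loopFalse {e : Expr} {p : Prog} {s : State} :
      e.eval s = 0 → Exec (.loop e p) s s (e.cost s + 1)

/-- Programs are deterministic, in result and running time. -/
theorem Exec.deterministic {p : Prog} {s s₁ s₂ : State} {t₁ t₂ : ℕ}
    (h₁ : Exec p s s₁ t₁) (h₂ : Exec p s s₂ t₂) : s₁ = s₂ ∧ t₁ = t₂ := by
  induction h₁ generalizing s₂ t₂ with
  | skip s => cases h₂; exact ⟨rfl, rfl⟩
  | store s a i e => cases h₂; exact ⟨rfl, rfl⟩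
  | seq _ _ ih₁ ih₂ =>
    cases h₂ with
    | seq h h' =>
      obtain ⟨rfl, rfl⟩ := ih₁ h
      obtain ⟨rfl, rfl⟩ := ih₂ h'
      exact ⟨rfl, rfl⟩
  | iteTrue he _ ih =>
    cases h₂ with
    | iteTrue _ h => obtain ⟨rfl, rfl⟩ := ih h; exact ⟨rfl, rfl⟩
    | iteFalse he' _ => exact absurd he' he
  | iteFalse he _ ih =>
    cases h₂ with
    | iteTrue he' _ => exact absurd he he'
    | iteFalse _ h => obtain ⟨rfl, rfl⟩ := ih h; exact ⟨rfl, rfl⟩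
  | loopTrue he _ _ ih₁ ih₂ =>
    cases h₂ with
    | loopTrue _ h h' =>
      obtain ⟨rfl, rfl⟩ := ih₁ h
      obtain ⟨rfl, rfl⟩ := ih₂ h'
      exact ⟨rfl, rfl⟩
    | loopFalse he' => exact absurd he' he
  | loopFalse he =>
    cases h₂ with
    | loopTrue he' _ _ => exact absurd he he'
    | loopFalse _ => exact ⟨rfl, rfl⟩

/-- Started in `s`, the program halts within time `T`, in a state that satisfies `post`. -/
def RunsWithin (p : Prog) (s : State) (T : ℝ) (post : State → Prop) : Prop :=
  ∃ (s' : State) (t : ℕ), Exec p s s' t ∧ (t : ℝ) ≤ T ∧ post s'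

/-- Results are delivered in this array. -/
def outArray : ℕ := 5

/-! ### Input formats -/

/-- The array that holds the numbers `v 0, …, v (n - 1)`, followed by zeros. -/
def natArray {n : ℕ} (v : Fin n → ℕ) : ℕ → ℕ :=
  fun p => if h : p < n then v ⟨p, h⟩ else 0

/-- A rational number `x` occupies three cells, that hold `a`, `b`, `c` with `x = (a - b) / c`:
the positive and the negative part of the numerator, and the denominator. -/
def ratCode (x : ℚ) : Fin 3 → ℕ :=
  ![x.num.toNat, (-x.num).toNat, x.den]

/-- The array that holds the codes of `v 0, …, v (n - 1)`, followed by zeros. -/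
def ratArray {n : ℕ} (v : Fin n → ℚ) : ℕ → ℕ :=
  fun p => if h : p / 3 < n then ratCode (v ⟨p / 3, h⟩) ⟨p % 3, Nat.mod_lt p (by norm_num)⟩ else 0

/-- Row-major order: the entry `f i j` is at position `i * b + j`. -/
def rowMajor {α : Type} {a b : ℕ} (f : Fin a → Fin b → α) : Fin (a * b) → α :=
  fun p => f p.divNat p.modNat

end RAM

open RAM

/-! ## The 3-OV hypothesis -/

/-- Three `0`-`1` vectors are orthogonal: in every coordinate, one of them is `0`. -/
def OrthogonalTriple {d : ℕ} (u v w : Fin d → Bool) : Prop :=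
  ∀ j, u j = false ∨ v j = false ∨ w j = false

/-- The input of a 3-OV instance: `n` and `d` in array `0`, the three families of vectors in the
arrays `1`, `2`, `3`. -/
def ovInput {n d : ℕ} (A B C : Fin n → Fin d → Bool) : State
  | 0 => natArray ![n, d]
  | 1 => natArray (rowMajor fun i j => (A i j).toNat)
  | 2 => natArray (rowMajor fun i j => (B i j).toNat)
  | 3 => natArray (rowMajor fun i j => (C i j).toNat)
  | _ => fun _ => 0

/-- The program `P` decides 3-OV on three families of `n` vectors of dimension `d n` in time
`O(T n)`. -/
def SolvesThreeOV (P : Prog) (d : ℕ → ℕ) (T : ℕ → ℝ) : Prop :=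
  ∃ K : ℝ, ∀ᶠ n : ℕ in atTop, ∀ A B C : Fin n → Fin (d n) → Bool,
    RunsWithin P (ovInput A B C) (K * T n) fun s =>
      (s outArray 0 ≠ 0 ↔ ∃ i j k, OrthogonalTriple (A i) (B j) (C k))

/-- The 3-OV hypothesis: deciding 3-OV on `n` vectors of dimension `Θ(log n)` requires time
`n ^ (3 - o(1))`.  That is, for every `ε > 0` there is a constant `c` such that no algorithm runs in
time `O(n ^ (3 - ε))` in dimension `c * ⌈log₂ n⌉`. -/
def ThreeOVHypothesis : Prop :=
  ∀ ε : ℝ, 0 < ε → ∃ c : ℕ,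
    ¬ ∃ P : Prog, SolvesThreeOV P (fun n => c * Nat.clog 2 n) (fun n => (n : ℝ) ^ (3 - ε))

/-! ## Transformers -/

noncomputable section

/-- The softmax of a vector. -/
def softmax {N : ℕ} (v : Fin N → ℝ) : Fin N → ℝ :=
  fun i => Real.exp (v i) / ∑ j, Real.exp (v j)

/-- A self-attention head with embedding dimension `m`, given by its query, key and value
embeddings, which act on single tokens. -/
structure AttentionHead (m : ℕ) where
  Q : (Fin m → ℝ) → Fin m → ℝ
  K : (Fin m → ℝ) → Fin m → ℝ
  V : (Fin m → ℝ) → Fin m → ℝ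

/-- `softmax (Q(X) K(X)ᵀ) V(X)`, where `Q`, `K`, `V` and softmax are applied row by row. -/
def AttentionHead.apply {m N : ℕ} (f : AttentionHead m) (X : Matrix (Fin N) (Fin m) ℝ) :
    Matrix (Fin N) (Fin m) ℝ :=
  let q : Matrix (Fin N) (Fin m) ℝ := Matrix.of fun i => f.Q (X i)
  let k : Matrix (Fin N) (Fin m) ℝ := Matrix.of fun i => f.K (X i)
  let v : Matrix (Fin N) (Fin m) ℝ := Matrix.of fun i => f.V (X i)
  (Matrix.of fun i => softmax ((q * k.transpose) i)) * v

/-- A transformer with embedding and input dimension `m`, `L` layers, `H` heads in each layer,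
output dimension `dout`, and summation aggregation; an MLP is a continuous map, which is applied to
every row. -/
structure Transformer (m L H dout : ℕ) where
  head : Fin L → Fin H → AttentionHead m
  mlp : Fin L → C(Fin m → ℝ, Fin m → ℝ)
  outMlp : C(Fin m → ℝ, Fin dout → ℝ)

namespace Transformer

variable {m L H dout N : ℕ}

/-- `X ↦ Ψ_ℓ (X + ∑ h, f_{ℓ, h} (X))`. -/
def layer (T : Transformer m L H dout) (ℓ : Fin L) (X : Matrix (Fin N) (Fin m) ℝ) :
    Matrix (Fin N) (Fin m) ℝ :=
  Matrix.of fun i => T.mlp ℓ ((X + ∑ h, (T.head ℓ h).apply X) i)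

/-- The output on input `X`: the layers `0, …, L - 1` are applied in this order, and then the output
MLP. -/
def eval (T : Transformer m L H dout) (X : Matrix (Fin N) (Fin m) ℝ) :
    Matrix (Fin N) (Fin dout) ℝ :=
  Matrix.of fun i => T.outMlp (Fin.foldl L (fun Y ℓ => T.layer ℓ Y) X i)

end Transformer

/-- Rational weight matrices for the query, key and value embeddings of all heads. -/
structure Weights (m L H : ℕ) where
  Q : Fin L → Fin H → Matrix (Fin m) (Fin m) ℚ
  K : Fin L → Fin H → Matrix (Fin m) (Fin m) ℚ
  V : Fin L → Fin H → Matrix (Fin m) (Fin m) ℚ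

/-- The transformer without MLPs (all of them are the identity) whose embeddings are the linear maps
`x ↦ x W` for the given weight matrices `W`. -/
def Weights.transformer {m L H : ℕ} (W : Weights m L H) : Transformer m L H m where
  head ℓ h :=
    { Q := fun x => Matrix.vecMul x ((W.Q ℓ h).map (fun r : ℚ => (r : ℝ)))
      K := fun x => Matrix.vecMul x ((W.K ℓ h).map (fun r : ℚ => (r : ℝ)))
      V := fun x => Matrix.vecMul x ((W.V ℓ h).map (fun r : ℚ => (r : ℝ))) }
  mlp _ := ContinuousMap.id _
  outMlp := ContinuousMap.id _

end

/-! ## Algorithms that compute transformers -/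

/-- The numerator and the denominator of `x` are at most `B` in absolute value. -/
def RatBounded (B : ℕ) (x : ℚ) : Prop :=
  x.num.natAbs ≤ B ∧ x.den ≤ B

def Weights.Bounded {m L H : ℕ} (B : ℕ) (W : Weights m L H) : Prop :=
  ∀ ℓ h i j, RatBounded B (W.Q ℓ h i j) ∧ RatBounded B (W.K ℓ h i j) ∧ RatBounded B (W.V ℓ h i j)

/-- All weight matrices, one after the other, each in row-major order. -/
def flattenWeights {m L H : ℕ} (W : Fin L → Fin H → Matrix (Fin m) (Fin m) ℚ) :
    Fin (L * (H * (m * m))) → ℚ :=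
  rowMajor fun ℓ => rowMajor fun h => rowMajor fun i j => W ℓ h i j

/-- The input of an algorithm that computes transformers: the parameters in array `0`, the tokens in
array `1`, the weights in the arrays `2`, `3`, `4`. -/
def transformerInput {N m L H : ℕ} (W : Weights m L H) (X : Matrix (Fin N) (Fin m) ℚ) : State
  | 0 => natArray ![N, m, L, H]
  | 1 => ratArray (rowMajor fun i j => X i j)
  | 2 => ratArray (flattenWeights W.Q)
  | 3 => ratArray (flattenWeights W.K)
  | 4 => ratArray (flattenWeights W.V)
  | _ => fun _ => 0

/-- The output array holds, for each entry of `Y` in row-major order, three numbers `a`, `b`, `c`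
with `c ≠ 0` such that `(a - b) / c` is the entry up to an additive error of at most `δ`. -/
def OutputsApprox {N m : ℕ} (Y : Matrix (Fin N) (Fin m) ℝ) (δ : ℝ) (s : State) : Prop :=
  ∀ (i : Fin N) (j : Fin m),
    let p := 3 * ((i : ℕ) * m + j)
    s outArray (p + 2) ≠ 0 ∧
      |((s outArray p : ℝ) - (s outArray (p + 1) : ℝ)) / (s outArray (p + 2) : ℝ) - Y i j| ≤ δ

/-- In time `O(T N)`, the program `P` computes, up to entry-wise additive error `1 / (10 N)`, all
transformers without MLPs with input length `N`, embedding, input and output dimension `m N`, with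
`L N` layers and `H N` heads in each layer, whose embeddings are given by weight matrices; the
numerators and denominators of weights and inputs are at most `N ^ b`, so they have `O(log N)`
bits. -/
def ComputesTransformers (P : Prog) (m L H : ℕ → ℕ) (b : ℕ) (T : ℕ → ℝ) : Prop :=
  ∃ K : ℝ, ∀ᶠ N : ℕ in atTop,
    ∀ (W : Weights (m N) (L N) (H N)) (X : Matrix (Fin N) (Fin (m N)) ℚ),
      W.Bounded (N ^ b) → (∀ i j, RatBounded (N ^ b) (X i j)) →
        RunsWithin P (transformerInput W X) (K * T N)
          (OutputsApprox (W.transformer.eval (X.map (fun r : ℚ => (r : ℝ)))) (1 / (10 * (N : ℝ))))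

/-- The parameters `m N`, `L N`, `H N` can be computed from `N` in time `O(T N)`. -/
def ComputableParams (m L H : ℕ → ℕ) (T : ℕ → ℝ) : Prop :=
  ∃ (P : Prog) (K : ℝ), ∀ᶠ N : ℕ in atTop,
    RunsWithin P (fun a => if a = 0 then natArray ![N] else fun _ => 0) (K * T N) fun s =>
      s outArray 0 = m N ∧ s outArray 1 = L N ∧ s outArray 2 = H N

/-! A single head can look for orthogonal triples. Give every token `j ≠ 0` a vector `v j` of the
second family together with the complement of a vector `w j` of the third family, and give token
`0` the all-ones vector in place of a complement. In the head for a vector `u` of the first family,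
the attention score of token `j` for token `k` is `N` times the number of coordinates where `u`,
`v j` and the complement of `w k` are all `1`. Token `0` attains the largest score, and token `k`
attains it too if and only if `u`, `v j` and `w k` are orthogonal; otherwise it is behind by at
least `N`. So the attention that token `j` pays to the tokens `k ≠ 0` is at least `1 / 2` if there
is an orthogonal triple, and at most `N * exp (-N)` otherwise, and the residual connection adds it
up over all heads.

Let `N` be about `n ^ (1 / (2 * k + 2))`. With blocks of `N - 1` vectors of the second and the
third family and groups of `L * H` vectors of the first, `n ^ 3 / (L * H * N ^ 2)` transformers, up
to a constant factor, cover all triples, so saving a factor `N ^ ε` on each of them refutes the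
hypothesis. The algorithm for transformers expects memory that is zero outside of its input, and
one run of it may leave traces anywhere, so each run is simulated in its own residue class of the
addresses. -/

namespace RAM

/-! ## Cost of expressions and programs -/

namespace Expr

instance : Add Expr := ⟨.bin .add⟩
instance : Sub Expr := ⟨.bin .sub⟩
instance : Mul Expr := ⟨.bin .mul⟩
instance : Div Expr := ⟨.bin .div⟩
instance (n : ℕ) : OfNat Expr n := ⟨.lit n⟩

/-- The remainder of `x` modulo `y`; it is `x` if `y = 0`. -/
def mod (x y : Expr) : Expr := x - x / y * y

/-- The indicator of `x < y`. -/
def lt (x y : Expr) : Expr := 1 - (x + 1 - y)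

/-- The indicator of `x = y`. -/
def eq (x y : Expr) : Expr := 1 - ((x - y) + (y - x))

/-- The power `x ^ e` with a constant exponent. -/
def pow (x : Expr) : ℕ → Expr
  | 0 => 1
  | e + 1 => x.pow e * x

/-- Every memory cell that is read when the expression is evaluated in `s` holds a number of at most
`β` bits. -/
def BoundedReads (s : State) (β : ℕ) : Expr → Prop
  | lit _ => True
  | load a e => (s a (e.eval s)).size ≤ β ∧ e.BoundedReads s β
  | bin _ e₁ e₂ => e₁.BoundedReads s β ∧ e₂.BoundedReads s β

/-- The cost of an expression that reads numbers of at most `β ≥ 1` bits is at most `weight * β`. -/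
def weight : Expr → ℕ
  | lit n => 1 + n.size
  | load _ e => e.weight + 2
  | bin _ e₁ e₂ => 2 * (e₁.weight + e₂.weight) + 2

variable (s : State) (x y : Expr) (β : ℕ)

@[simp] theorem eval_add : (x + y).eval s = x.eval s + y.eval s := rfl
@[simp] theorem eval_sub : (x - y).eval s = x.eval s - y.eval s := rfl
@[simp] theorem eval_mul : (x * y).eval s = x.eval s * y.eval s := rfl
@[simp] theorem eval_div : (x / y).eval s = x.eval s / y.eval s := rfl
@[simp] theorem eval_load (a : ℕ) : (load a x).eval s = s a (x.eval s) := rfl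
@[simp] theorem eval_ofNat (n : ℕ) :
    (no_index (OfNat.ofNat n : Expr)).eval s = OfNat.ofNat n := rfl

@[simp] theorem eval_mod : (mod x y).eval s = x.eval s % y.eval s := by
  simp only [mod, eval_sub, eval_mul, eval_div]
  rw [mul_comm, ← Nat.mod_eq_sub_mul_div]

@[simp] theorem eval_lt : (lt x y).eval s = if x.eval s < y.eval s then 1 else 0 := by
  simp only [lt, eval_sub, eval_add, eval_ofNat]
  split_ifs <;> omega

@[simp] theorem eval_eq : (eq x y).eval s = if x.eval s = y.eval s then 1 else 0 := by
  simp only [eq, eval_sub, eval_add, eval_ofNat]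
  split_ifs <;> omega

@[simp] theorem eval_pow (e : ℕ) : (x.pow e).eval s = x.eval s ^ e := by
  induction e with
  | zero => simp [pow]
  | succ e ih => simp [pow, ih, _root_.pow_succ]

@[simp] theorem boundedReads_add :
    (x + y).BoundedReads s β ↔ x.BoundedReads s β ∧ y.BoundedReads s β := Iff.rfl
@[simp] theorem boundedReads_sub :
    (x - y).BoundedReads s β ↔ x.BoundedReads s β ∧ y.BoundedReads s β := Iff.rfl
@[simp] theorem boundedReads_mul :
    (x * y).BoundedReads s β ↔ x.BoundedReads s β ∧ y.BoundedReads s β := Iff.rfl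
@[simp] theorem boundedReads_div :
    (x / y).BoundedReads s β ↔ x.BoundedReads s β ∧ y.BoundedReads s β := Iff.rfl
@[simp] theorem boundedReads_load (a : ℕ) :
    (load a x).BoundedReads s β ↔ (s a (x.eval s)).size ≤ β ∧ x.BoundedReads s β := Iff.rfl
@[simp] theorem boundedReads_ofNat (n : ℕ) :
    (no_index (OfNat.ofNat n : Expr)).BoundedReads s β := trivial

@[simp] theorem boundedReads_mod :
    (mod x y).BoundedReads s β ↔ x.BoundedReads s β ∧ y.BoundedReads s β := by
  simp [mod]

@[simp] theorem boundedReads_lt :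
    (lt x y).BoundedReads s β ↔ x.BoundedReads s β ∧ y.BoundedReads s β := by
  simp [lt]

@[simp] theorem boundedReads_eq :
    (eq x y).BoundedReads s β ↔ x.BoundedReads s β ∧ y.BoundedReads s β := by
  simp only [eq, boundedReads_sub, boundedReads_add, boundedReads_ofNat]
  tauto

variable {s x β}

theorem BoundedReads.pow (h : x.BoundedReads s β) : ∀ e, (x.pow e).BoundedReads s β
  | 0 => trivial
  | e + 1 => ⟨BoundedReads.pow h e, h⟩

theorem BoundedReads.mono {β' : ℕ} (hβ : β ≤ β') {x : Expr} (h : x.BoundedReads s β) :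
    x.BoundedReads s β' := by
  induction x with
  | lit n => trivial
  | load a e ih => exact ⟨h.1.trans hβ, ih h.2⟩
  | bin o e₁ e₂ ih₁ ih₂ => exact ⟨ih₁ h.1, ih₂ h.2⟩

theorem size_eval_lt_cost (s : State) (x : Expr) : (x.eval s).size < x.cost s := by
  cases x <;> simp only [eval, cost] <;> omega

end Expr

theorem size_add_le (x y : ℕ) : (x + y).size ≤ max x.size y.size + 1 := by
  rw [Nat.size_le, pow_succ]
  have hx : x < 2 ^ max x.size y.size := Nat.size_le.1 (le_max_left _ _)
  have hy : y < 2 ^ max x.size y.size := Nat.size_le.1 (le_max_right _ _)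
  omega

theorem size_mul_le (x y : ℕ) : (x * y).size ≤ x.size + y.size := by
  rw [Nat.size_le, pow_add]
  exact Nat.mul_lt_mul'' (Nat.lt_size_self x) (Nat.lt_size_self y)

theorem Op.size_eval_le (o : Op) (x y : ℕ) : (o.eval x y).size ≤ x.size + y.size + 1 := by
  cases o with
  | add => have := size_add_le x y; simp only [Op.eval]; omega
  | sub => have := Nat.size_le_size (Nat.sub_le x y); simp only [Op.eval]; omega
  | mul => have := size_mul_le x y; simp only [Op.eval]; omega
  | div => have := Nat.size_le_size (Nat.div_le_self x y); simp only [Op.eval]; omega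

theorem Expr.BoundedReads.cost_le {s : State} {β : ℕ} (hβ : 1 ≤ β) {x : Expr}
    (h : x.BoundedReads s β) : x.cost s ≤ x.weight * β := by
  induction x with
  | lit n => exact Nat.le_mul_of_pos_right _ hβ
  | load a e ih =>
    have h₁ := ih h.2
    have h₂ := h.1
    simp only [cost, weight, add_mul]
    omega
  | bin o x y ihx ihy =>
    have h₁ := ihx h.1
    have h₂ := ihy h.2
    have h₃ := o.size_eval_le (x.eval s) (y.eval s)
    have h₄ := x.size_eval_lt_cost s
    have h₅ := y.size_eval_lt_cost s
    simp only [cost, weight, add_mul, mul_add, mul_assoc]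
    omega

/-- The number of time units that one pass over the text of the program takes, in multiples of the
bit length of the numbers that it reads. -/
def Prog.weight : Prog → ℕ
  | skip => 1
  | store _ i e => i.weight + e.weight + 1
  | seq p q => p.weight + q.weight
  | ite e p q => e.weight + 1 + (p.weight + q.weight)
  | loop e p => e.weight + 1 + p.weight

theorem Prog.weight_pos (p : Prog) : 1 ≤ p.weight := by
  induction p <;> simp only [weight] <;> omega

/-- Started in `s`, the program `p` halts in a state that satisfies `post`, and its running time is
at most `T` up to the factor `p.weight`, which depends on the text of the program only. -/
def Runs (p : Prog) (s : State) (T : ℕ) (post : State → Prop) : Prop :=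
  RunsWithin p s (p.weight * T : ℕ) post

section Rules

variable {p q : Prog} {s : State} {T T' a : ℕ} {post post' : State → Prop} {e i : Expr}

theorem RunsWithin.mono {T₁ T₂ : ℝ} (h : RunsWithin p s T₁ post) (hT : T₁ ≤ T₂)
    (hp : ∀ s', post s' → post' s') : RunsWithin p s T₂ post' := by
  obtain ⟨s', t, hexec, ht, hs'⟩ := h
  exact ⟨s', t, hexec, ht.trans hT, hp _ hs'⟩

namespace Runs

theorem of_exec {s' : State} {t : ℕ} (h : Exec p s s' t) (ht : t ≤ p.weight * T) (hp : post s') :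
    Runs p s T post :=
  ⟨s', t, h, Nat.cast_le.2 ht, hp⟩

theorem exists_exec (h : Runs p s T post) : ∃ s' t, Exec p s s' t ∧ t ≤ p.weight * T ∧ post s' := by
  obtain ⟨s', t, hexec, ht, hp⟩ := h
  exact ⟨s', t, hexec, Nat.cast_le.1 ht, hp⟩

theorem mono (h : Runs p s T post) (hT : T ≤ T') (hp : ∀ s', post s' → post' s') :
    Runs p s T' post' :=
  RunsWithin.mono h (Nat.cast_le.2 (Nat.mul_le_mul_left _ hT)) hp

theorem skip (hT : 1 ≤ T) (h : post s) : Runs .skip s T post :=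
  of_exec (.skip s) (by simpa [Prog.weight] using hT) h

theorem store (hT : 1 ≤ T) (hi : i.BoundedReads s T) (he : e.BoundedReads s T)
    (h : post (s.write a (i.eval s) (e.eval s))) : Runs (.store a i e) s T post := by
  refine of_exec (.store s a i e) ?_ h
  have h₁ := hi.cost_le hT
  have h₂ := he.cost_le hT
  rw [Prog.weight, add_mul, add_mul]
  omega

theorem seq (h : Runs p s T post) (h' : ∀ s', post s' → Runs q s' T post') :
    Runs (.seq p q) s T post' := by
  obtain ⟨s₁, t₁, hexec₁, ht₁, hs₁⟩ := h.exists_exec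
  obtain ⟨s₂, t₂, hexec₂, ht₂, hs₂⟩ := (h' s₁ hs₁).exists_exec
  exact of_exec (hexec₁.seq hexec₂) (by rw [Prog.weight, add_mul]; omega) hs₂

theorem ite (hT : 1 ≤ T) (he : e.BoundedReads s T) (h₁ : e.eval s ≠ 0 → Runs p s T post)
    (h₂ : e.eval s = 0 → Runs q s T post) : Runs (.ite e p q) s T post := by
  have hcost := he.cost_le hT
  have hweight : (Prog.ite e p q).weight * T =
      e.weight * T + T + (p.weight * T + q.weight * T) := by
    simp only [Prog.weight, add_mul, one_mul]
  by_cases h : e.eval s = 0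
  · obtain ⟨s', t, hexec, ht, hp⟩ := (h₂ h).exists_exec
    exact of_exec (.iteFalse h hexec) (by omega) hp
  · obtain ⟨s', t, hexec, ht, hp⟩ := (h₁ h).exists_exec
    exact of_exec (.iteTrue h hexec) (by omega) hp

theorem loop (I : ℕ → State → Prop) (c : ℕ → ℕ) (hc : ∀ j, 1 ≤ c j) {a b : ℕ} (hab : a ≤ b)
    (hcond : ∀ j s, I j s → e.BoundedReads s (c j))
    (hstep : ∀ j s, a ≤ j → j < b → I j s → e.eval s ≠ 0 ∧ Runs p s (c j) (I (j + 1)))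
    (hend : ∀ s, I b s → e.eval s = 0) (hs : I a s) :
    Runs (.loop e p) s (∑ j ∈ Finset.Ico a (b + 1), c j) (I b) := by
  have hweight (T : ℕ) : (Prog.loop e p).weight * T = e.weight * T + T + p.weight * T := by
    simp only [Prog.weight, add_mul, one_mul]
  induction hab using Nat.decreasingInduction generalizing s with
  | self =>
    have hcost := (hcond b s hs).cost_le (hc b)
    have hpos := hc b
    refine of_exec (.loopFalse (hend s hs)) ?_ hs
    rw [hweight, Nat.Ico_succ_singleton, Finset.sum_singleton]
    omega
  | of_succ a hab ih =>
    obtain ⟨he, hbody⟩ := hstep a s le_rfl hab hs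
    obtain ⟨s₁, t₁, hexec₁, ht₁, hs₁⟩ := hbody.exists_exec
    obtain ⟨s₂, t₂, hexec₂, ht₂, hs₂⟩ :=
      (ih (fun j s hj => hstep j s (by omega)) hs₁).exists_exec
    have hcost := (hcond a s hs).cost_le (hc a)
    have hpos := hc a
    refine of_exec (.loopTrue he hexec₁ hexec₂) ?_ hs₂
    rw [Finset.sum_eq_sum_Ico_succ_bot (by omega : a < b + 1), mul_add, hweight (c a)]
    omega

theorem loop_const (I : ℕ → State → Prop) (hT : 1 ≤ T) (b : ℕ)
    (hcond : ∀ j s, I j s → e.BoundedReads s T)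
    (hstep : ∀ j s, j < b → I j s → e.eval s ≠ 0 ∧ Runs p s T (I (j + 1)))
    (hend : ∀ s, I b s → e.eval s = 0) (hs : I 0 s) :
    Runs (.loop e p) s (T * (b + 1)) (I b) := by
  simpa [mul_comm T] using loop I (fun _ => T) (fun _ => hT) (Nat.zero_le b) hcond
    (fun j s _ => hstep j s) hend hs

end Runs

theorem RunsWithin.runs (h : RunsWithin p s T post) : Runs p s T post :=
  h.mono (Nat.cast_le.2 (Nat.le_mul_of_pos_left _ p.weight_pos)) fun _ => id

theorem RunsWithin.floor {T : ℝ} (h : RunsWithin p s T post) : RunsWithin p s ⌊T⌋₊ post := by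
  obtain ⟨s', t, hexec, ht, hp⟩ := h
  exact ⟨s', t, hexec, Nat.cast_le.2 (Nat.le_floor ht), hp⟩

end Rules

/-- Writing a number costs its bit length, so each unit of time can pay for one new bit. -/
theorem Exec.sum_size_le {p : Prog} {s s' : State} {t : ℕ} (h : Exec p s s' t) (a : ℕ)
    (F : Finset ℕ) :
    ∑ x ∈ F, (s' a x).size ≤ ∑ x ∈ F, (s a x).size + t := by
  induction h with
  | skip => omega
  | store s b i e =>
    have hwrite : ∀ x ∈ F, (s.write b (i.eval s) (e.eval s) a x).size ≤
        (s a x).size + if x = i.eval s then (e.eval s).size else 0 := by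
      intro x _
      simp only [State.write]
      split_ifs <;> omega
    have hcost := e.size_eval_lt_cost s
    refine (Finset.sum_le_sum hwrite).trans ?_
    rw [Finset.sum_add_distrib, Finset.sum_ite_eq']
    split_ifs <;> omega
  | seq _ _ ih₁ ih₂ => omega
  | iteTrue _ _ ih => omega
  | iteFalse _ _ ih => omega
  | loopTrue _ _ _ ih₁ ih₂ => omega
  | loopFalse => omega

/-! ## Simulation of a program in one residue class of the memory -/

/-- The address in the memory of the simulator of cell `x` of the simulated memory: part `i` of an
array consists of the cells that are congruent to `i` modulo `M`, where `M` and `i` are kept in the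
cells `0` and `1` of array `6`. -/
def Expr.addr (x : Expr) : Expr := x * .load 6 0 + .load 6 1

@[simp] theorem Expr.eval_addr (s : State) (x : Expr) :
    x.addr.eval s = x.eval s * s 6 0 + s 6 1 := rfl

/-- The expression for the simulated memory, whose array `a` is kept in array `f a`. -/
def Expr.relocate (f : ℕ → ℕ) : Expr → Expr
  | .lit n => .lit n
  | .load a e => .load (f a) (e.relocate f).addr
  | .bin o e₁ e₂ => .bin o (e₁.relocate f) (e₂.relocate f)

/-- The program that simulates a program, where array `a` of the simulated memory is kept in array
`f a`. -/
def Prog.relocate (f : ℕ → ℕ) : Prog → Prog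
  | .skip => .skip
  | .store a i e => .store (f a) (i.relocate f).addr (e.relocate f)
  | .seq p q => .seq (p.relocate f) (q.relocate f)
  | .ite e p q => .ite (e.relocate f) (p.relocate f) (q.relocate f)
  | .loop e p => .loop (e.relocate f) (p.relocate f)

/-- The state `s` simulates the memory `v` in part `ρ 1` of the arrays `f 0, f 1, …`. Array `6`
holds the registers `ρ`, where `ρ 0` is the number of parts, and all other cells are as in
`base`. -/
structure Simulates (f : ℕ → ℕ) (base : State) (ρ : ℕ → ℕ) (v s : State) : Prop where
  part_lt : ρ 1 < ρ 0
  register : s 6 = ρ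
  cell : ∀ a x, s (f a) (x * ρ 0 + ρ 1) = v a x
  frame : ∀ a x, a ≠ 6 → ((∀ b, a ≠ f b) ∨ x % ρ 0 ≠ ρ 1) → s a x = base a x

namespace Simulates

variable {f : ℕ → ℕ} {base : State} {ρ : ℕ → ℕ} {v s : State}

theorem write (h : Simulates f base ρ v s) (hf : f.Injective) (hf6 : ∀ a, f a ≠ 6) (a x y : ℕ) :
    Simulates f base ρ (v.write a x y) (s.write (f a) (x * ρ 0 + ρ 1) y) where
  part_lt := h.part_lt
  register := by ext z; simp [State.write, (hf6 a).symm, h.register]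
  cell b z := by
    have hρ : ρ 0 ≠ 0 := (Nat.zero_le _).trans_lt h.part_lt |>.ne'
    simp [State.write, hf.eq_iff, hρ, h.cell]
  frame b z hb hbz := by
    rw [← h.frame b z hb hbz]
    refine if_neg ?_
    rintro ⟨rfl, rfl⟩
    rcases hbz with hb | hz
    · exact hb a rfl
    · exact hz (by rw [Nat.mul_add_mod', Nat.mod_eq_of_lt h.part_lt])

theorem write_register (h : Simulates f base ρ v s) (hf6 : ∀ a, f a ≠ 6) {x : ℕ} (hx : 2 ≤ x)
    (y : ℕ) : Simulates f base (Function.update ρ x y) v (s.write 6 x y) := by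
  have h0 : Function.update ρ x y 0 = ρ 0 := Function.update_of_ne (by omega) _ _
  have h1 : Function.update ρ x y 1 = ρ 1 := Function.update_of_ne (by omega) _ _
  refine ⟨by rw [h0, h1]; exact h.part_lt, ?_, ?_, ?_⟩
  · ext z
    simp [State.write, Function.update_apply, h.register]
  · intro a z
    rw [h0, h1, ← h.cell]
    simp [State.write, hf6]
  · intro a z ha haz
    rw [h0, h1] at haz
    rw [← h.frame a z ha haz]
    simp [State.write, ha]

theorem eval_relocate (h : Simulates f base ρ v s) (e : Expr) :
    (e.relocate f).eval s = e.eval v := by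
  induction e with
  | lit n => rfl
  | load a e ih => simp [Expr.relocate, ih, h.register, h.cell, Expr.eval]
  | bin o x y ihx ihy => simp [Expr.relocate, ihx, ihy, Expr.eval]

theorem cost_addr_le (h : Simulates f base ρ v s) (x : Expr) :
    x.addr.cost s ≤ x.cost s + 2 * (x.eval s).size + 4 * (ρ 0).size + 8 := by
  have hmul := size_mul_le (x.eval s) (ρ 0)
  have hadd := size_add_le (x.eval s * ρ 0) (ρ 1)
  have hpart := Nat.size_le_size h.part_lt.le
  have hcost : x.addr.cost s = x.cost s + (1 + (0 : ℕ).size + (1 + (ρ 0).size)) +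
      (1 + (x.eval s * ρ 0).size) + (1 + (1 : ℕ).size + (1 + (ρ 1).size)) +
        (1 + (x.eval s * ρ 0 + ρ 1).size) := by
    rw [← h.register]
    rfl
  rw [hcost, Nat.size_zero, Nat.size_one]
  omega

theorem cost_relocate_add_size_le (h : Simulates f base ρ v s) (e : Expr) :
    (e.relocate f).cost s + 2 * (e.eval v).size ≤ (4 * (ρ 0).size + 9) * e.cost v := by
  induction e with
  | lit n => simp only [Expr.relocate, Expr.cost, Expr.eval]; nlinarith
  | load a e ih =>
    have haddr := h.cost_addr_le (e.relocate f)
    simp only [Expr.relocate, Expr.cost, Expr.eval, Expr.eval_addr, h.eval_relocate, h.register,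
      h.cell] at haddr ⊢
    nlinarith
  | bin o x y ihx ihy =>
    simp only [Expr.relocate, Expr.cost, Expr.eval, h.eval_relocate] at ihx ihy ⊢
    nlinarith

theorem cost_relocate_le (h : Simulates f base ρ v s) (e : Expr) :
    (e.relocate f).cost s + 1 ≤ (4 * (ρ 0).size + 9) * (e.cost v + 1) := by
  have := h.cost_relocate_add_size_le e
  rw [mul_add]
  omega

end Simulates

theorem charge_add_le {κ c c' t t' : ℕ} (hc : c' + 1 ≤ κ * (c + 1)) (ht : t' ≤ κ * t) :
    c' + 1 + t' ≤ κ * (c + 1 + t) := by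
  rw [mul_add κ (c + 1)]
  exact add_le_add hc ht

section Relocate

variable {f : ℕ → ℕ} {base : State} {ρ : ℕ → ℕ} {v s : State} {p : Prog}

/-- The factor `O(log (ρ 0))` is the cost of the longer addresses. -/
theorem Exec.relocate (hf : f.Injective) (hf6 : ∀ a, f a ≠ 6) {v' : State} {t : ℕ}
    (hp : Exec p v v' t) (s : State) (h : Simulates f base ρ v s) :
    ∃ s' t', Exec (p.relocate f) s s' t' ∧ t' ≤ (4 * (ρ 0).size + 9) * t ∧
      Simulates f base ρ v' s' := by
  induction hp generalizing s with
  | skip v => exact ⟨s, _, .skip s, by omega, h⟩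
  | store v a j e =>
    refine ⟨_, _, .store s (f a) (j.relocate f).addr (e.relocate f), ?_, ?_⟩
    · have haddr := h.cost_addr_le (j.relocate f)
      have hj := h.cost_relocate_add_size_le j
      have he := h.cost_relocate_add_size_le e
      rw [h.eval_relocate] at haddr
      nlinarith
    · rw [Expr.eval_addr, h.eval_relocate, h.eval_relocate, h.register]
      exact h.write hf hf6 a _ _
  | seq _ _ ih₁ ih₂ =>
    obtain ⟨s₁, t₁, hexec₁, ht₁, hs₁⟩ := ih₁ s h
    obtain ⟨s₂, t₂, hexec₂, ht₂, hs₂⟩ := ih₂ s₁ hs₁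
    exact ⟨s₂, _, hexec₁.seq hexec₂, by rw [mul_add]; omega, hs₂⟩
  | @iteTrue e _ _ _ _ _ he _ ih =>
    obtain ⟨s', t', hexec, ht, hs'⟩ := ih s h
    exact ⟨s', _, .iteTrue (by rwa [h.eval_relocate]) hexec,
      charge_add_le (h.cost_relocate_le e) ht, hs'⟩
  | @iteFalse e _ _ _ _ _ he _ ih =>
    obtain ⟨s', t', hexec, ht, hs'⟩ := ih s h
    exact ⟨s', _, .iteFalse (by rwa [h.eval_relocate]) hexec,
      charge_add_le (h.cost_relocate_le e) ht, hs'⟩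
  | @loopTrue e _ _ _ _ _ _ he _ _ ih₁ ih₂ =>
    obtain ⟨s₁, t₁, hexec₁, ht₁, hs₁⟩ := ih₁ s h
    obtain ⟨s₂, t₂, hexec₂, ht₂, hs₂⟩ := ih₂ s₁ hs₁
    refine ⟨s₂, _, .loopTrue (by rwa [h.eval_relocate]) hexec₁ hexec₂, ?_, hs₂⟩
    have := charge_add_le (h.cost_relocate_le e) ht₁
    rw [mul_add]
    omega
  | @loopFalse e _ _ he =>
    exact ⟨s, _, .loopFalse (by rwa [h.eval_relocate]), h.cost_relocate_le e, h⟩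

theorem RunsWithin.relocate (hf : f.Injective) (hf6 : ∀ a, f a ≠ 6) {τ : ℕ}
    {post : State → Prop} (hp : RunsWithin p v τ post) (h : Simulates f base ρ v s) :
    Runs (p.relocate f) s ((4 * (ρ 0).size + 9) * τ) fun s' => ∃ v', post v' ∧
      (∀ a F, ∑ x ∈ F, (v' a x).size ≤ ∑ x ∈ F, (v a x).size + τ) ∧
        Simulates f base ρ v' s' := by
  obtain ⟨v', t, hexec, ht, hpost⟩ := hp
  replace ht : t ≤ τ := Nat.cast_le.1 ht
  obtain ⟨s', t', hexec', ht', hsim⟩ := hexec.relocate hf hf6 s h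
  have hsize (a : ℕ) (F : Finset ℕ) := (hexec.sum_size_le a F).trans (Nat.add_le_add_left ht _)
  exact RunsWithin.runs ⟨s', t', hexec',
    Nat.cast_le.2 (ht'.trans (Nat.mul_le_mul_left _ ht)), v', hpost, hsize, hsim⟩

theorem Simulates.store (h : Simulates f base ρ v s) (hf : f.Injective) (hf6 : ∀ a, f a ≠ 6)
    {T : ℕ} (hT : 1 ≤ T) (hρ : (ρ 0).size ≤ T) (a : ℕ) {x y : Expr} (hx : x.BoundedReads s T)
    (hy : y.BoundedReads s T) : Runs (.store (f a) x.addr y) s T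
      (Simulates f base ρ (v.write a (x.eval s) (y.eval s))) := by
  have hpart := (Nat.size_le_size h.part_lt.le).trans hρ
  refine Runs.store hT (by simp [Expr.addr, hx, h.register, hρ, hpart]) hy ?_
  rw [Expr.eval_addr, h.register]
  exact h.write hf hf6 a _ _

theorem Simulates.store_register (h : Simulates f base ρ v s) (hf6 : ∀ a, f a ≠ 6) {T : ℕ}
    (hT : 1 ≤ T) {x y : Expr} (hx : x.BoundedReads s T) (hx2 : 2 ≤ x.eval s)
    (hy : y.BoundedReads s T) : Runs (.store 6 x y) s T
      (Simulates f base (Function.update ρ (x.eval s) (y.eval s)) v) :=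
  Runs.store hT hx hy (h.write_register hf6 hx2 _)

end Relocate

end RAM

/-! ## A transformer that detects orthogonal triples -/

section Softmax

variable {N : ℕ} {v : Fin N → ℝ} {i k : Fin N}

theorem softmax_nonneg (v : Fin N → ℝ) (k : Fin N) : 0 ≤ softmax v k :=
  div_nonneg (Real.exp_pos _).le (Finset.sum_nonneg fun _ _ => (Real.exp_pos _).le)

theorem exp_le_sum_exp (v : Fin N → ℝ) (i : Fin N) : Real.exp (v i) ≤ ∑ j, Real.exp (v j) :=
  Finset.single_le_sum (f := fun j => Real.exp (v j)) (fun _ _ => (Real.exp_pos _).le)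
    (Finset.mem_univ i)

theorem sum_exp_pos (v : Fin N → ℝ) (i : Fin N) : 0 < ∑ j, Real.exp (v j) :=
  (Real.exp_pos _).trans_le (exp_le_sum_exp v i)

theorem sum_softmax_ne_add_softmax (v : Fin N → ℝ) (i : Fin N) :
    (∑ j with j ≠ i, softmax v j) + softmax v i = 1 := by
  rw [Finset.filter_ne', Finset.sum_erase_add _ _ (Finset.mem_univ i)]
  simp only [softmax]
  rw [← Finset.sum_div, div_self (sum_exp_pos v i).ne']

theorem softmax_le_exp_sub (v : Fin N → ℝ) (i k : Fin N) : softmax v k ≤ Real.exp (v k - v i) := by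
  rw [Real.exp_sub]
  exact div_le_div_of_nonneg_left (Real.exp_pos _).le (Real.exp_pos _) (exp_le_sum_exp v i)

theorem half_le_sum_softmax_ne (hki : k ≠ i) (hv : v i ≤ v k) :
    1 / 2 ≤ ∑ j with j ≠ i, softmax v j := by
  have hle : softmax v i ≤ softmax v k :=
    div_le_div_of_nonneg_right (Real.exp_le_exp.2 hv) (sum_exp_pos v i).le
  have hk : softmax v k ≤ ∑ j with j ≠ i, softmax v j :=
    Finset.single_le_sum (fun j _ => softmax_nonneg v j) (by simpa using hki)
  linarith [sum_softmax_ne_add_softmax v i]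

theorem sum_softmax_ne_le {δ : ℝ} (hv : ∀ k, k ≠ i → v k + δ ≤ v i) :
    ∑ j with j ≠ i, softmax v j ≤ N * Real.exp (-δ) := by
  have hk : ∀ k ∈ Finset.univ.filter (· ≠ i), softmax v k ≤ Real.exp (-δ) := fun k hk =>
    (softmax_le_exp_sub v i k).trans
      (Real.exp_le_exp.2 (by linarith [hv k (Finset.mem_filter.1 hk).2]))
  refine (Finset.sum_le_card_nsmul _ _ _ hk).trans ?_
  rw [nsmul_eq_mul]
  exact mul_le_mul_of_nonneg_right (Nat.cast_le.2 ((Finset.card_le_univ _).trans (by simp)))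
    (Real.exp_pos _).le

end Softmax

theorem AttentionHead.apply_eq {m N : ℕ} (f : AttentionHead m) (X : Matrix (Fin N) (Fin m) ℝ)
    (i : Fin N) (c : Fin m) :
    f.apply X i c = ∑ k, softmax (fun k => f.Q (X i) ⬝ᵥ f.K (X k)) k * f.V (X k) c := rfl

theorem vecMul_eq_of_single_entry {m : ℕ} {M : Matrix (Fin m) (Fin m) ℝ} {a b : Fin m}
    (x : Fin m → ℝ) (hM : ∀ a', a' ≠ a → M a' b = 0) : Matrix.vecMul x M b = x a * M a b :=
  Fintype.sum_eq_single a fun a' ha' => by simp [hM a' ha']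

namespace Weights

variable {m L H N : ℕ}

theorem layer_transformer (W : Weights m L H) (ℓ : Fin L) (X : Matrix (Fin N) (Fin m) ℝ) :
    W.transformer.layer ℓ X = X + ∑ h, (W.transformer.head ℓ h).apply X := rfl

theorem eval_transformer_eq_add_sum {W : Weights m L H} {P : Matrix (Fin N) (Fin m) ℝ → Prop}
    {D : Fin L → Matrix (Fin N) (Fin m) ℝ}
    (hlayer : ∀ ℓ Y, P Y → W.transformer.layer ℓ Y = Y + D ℓ) (hP : ∀ ℓ Y, P Y → P (Y + D ℓ))
    {X : Matrix (Fin N) (Fin m) ℝ} (hX : P X) : W.transformer.eval X = X + ∑ ℓ, D ℓ := by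
  have hfold (l : List (Fin L)) (Y : Matrix (Fin N) (Fin m) ℝ) (hY : P Y) :
      l.foldl (fun Y ℓ => W.transformer.layer ℓ Y) Y = Y + (l.map D).sum := by
    induction l generalizing Y with
    | nil => simp
    | cons ℓ l ih =>
      rw [List.foldl_cons, hlayer ℓ Y hY, ih _ (hP ℓ Y hY), List.map_cons, List.sum_cons, add_assoc]
  change Fin.foldl L (fun Y ℓ => W.transformer.layer ℓ Y) X = _
  rw [Fin.foldl_eq_foldl_finRange, hfold _ _ hX, Fin.sum_univ_def]

end Weights

namespace OrthogonalityGadget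

/-- Coordinate `b` of the vector that token `k` compares against: the complement of `w k`, and the
all-ones vector for token `0`, which therefore gets the maximal score. -/
def keyCoord (w : ℕ → ℕ → ℕ) (k b : ℕ) : ℕ := if k = 0 then 1 else 1 - w k b

/-- Entry `c` of token `j`, which carries the vector `v j`, the complement of `w j`, and a flag that
tells it apart from token `0`. -/
def tokenEntry (d : ℕ) (v w : ℕ → ℕ → ℕ) (j c : ℕ) : ℕ :=
  if c < d then v j c
  else if c < 2 * d then keyCoord w j (c - d)
  else if c = 2 * d ∧ j ≠ 0 then 1 else 0

/-- The case distinction as arithmetic, which is what the reduction evaluates. -/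
theorem tokenEntry_eq (d : ℕ) (v w : ℕ → ℕ → ℕ) (j c : ℕ) : tokenEntry d v w j c =
    (if c < d then 1 else 0) * v j c +
      (1 - if c < d then 1 else 0) * (if c < 2 * d then 1 else 0) *
        (1 - (if 0 < j then 1 else 0) * w j (c - d)) +
      (if c = 2 * d then 1 else 0) * (if 0 < j then 1 else 0) := by
  rcases Nat.eq_zero_or_pos j with rfl | hj
  · simp only [tokenEntry, keyCoord]
    split_ifs <;> omega
  · simp only [tokenEntry, keyCoord, if_neg hj.ne', if_pos hj]
    split_ifs <;> omega

/-- The entries of the query matrix, which multiplies the `v`-part of a token by `N * u`. -/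
def queryEntry (N d : ℕ) (u : ℕ → ℕ) (a b : ℕ) : ℕ := if a = b ∧ a < d then N * u a else 0

/-- The entries of the key matrix, which moves the `w`-part of a token to the front. -/
def keyEntry (d a b : ℕ) : ℕ := if a = b + d ∧ b < d then 1 else 0

/-- The entries of the value matrix, which writes the flag of a token to column `2 * d + 1`. -/
def valueEntry (d a b : ℕ) : ℕ := if a = 2 * d ∧ b = 2 * d + 1 then 1 else 0

/-- The weights with one head for each of the vectors `u 0, …, u (L * H - 1)`. -/
def weights (N d m L H : ℕ) (u : ℕ → ℕ → ℕ) : Weights m L H where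
  Q ℓ h := Matrix.of fun a b => (queryEntry N d (u (ℓ * H + h)) a b : ℚ)
  K _ _ := Matrix.of fun a b => (keyEntry d a b : ℚ)
  V _ _ := Matrix.of fun a b => (valueEntry d a b : ℚ)

/-- The tokens for the families `v` and `w`; the vector `w 0` is ignored. -/
def tokens (N d m : ℕ) (v w : ℕ → ℕ → ℕ) : Matrix (Fin N) (Fin m) ℚ :=
  Matrix.of fun j c => (tokenEntry d v w j c : ℚ)

/-- The output of the gadget, as a matrix over the reals. -/
noncomputable def output (N d m L H : ℕ) (u v w : ℕ → ℕ → ℕ) : Matrix (Fin N) (Fin m) ℝ :=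
  (weights N d m L H u).transformer.eval ((tokens N d m v w).map (fun r : ℚ => (r : ℝ)))

/-- The number of coordinates where `u` and `v j` are `1` and the vector of token `k` is `0`. -/
def agreements (d : ℕ) (u : ℕ → ℕ) (v w : ℕ → ℕ → ℕ) (j k : ℕ) : ℕ :=
  ∑ b ∈ Finset.range d, u b * v j b * keyCoord w k b

/-- The attention that token `j` pays to the tokens other than `0` in the head of the vector `u`. -/
noncomputable def attentionShare (N d : ℕ) (u : ℕ → ℕ) (v w : ℕ → ℕ → ℕ) (j : ℕ) : ℝ :=
  ∑ k with ((k : Fin N) : ℕ) ≠ 0, softmax (fun k : Fin N => (N * agreements d u v w j k : ℝ)) k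

/-- Token `j` forms an orthogonal triple with one of the vectors `u 0, …, u (R - 1)` and the vector
`w k` of one of the tokens `k ≠ 0`. -/
def InOrthogonalTriple (N d R : ℕ) (u v w : ℕ → ℕ → ℕ) (j : ℕ) : Prop :=
  ∃ r < R, ∃ k < N, k ≠ 0 ∧ ∀ b < d, u r b * v j b * w k b = 0

/-- The rows of `Y` start with the tokens; the layers of the gadget change column `2 * d + 1` only,
so they preserve this. -/
def CarriesTokens {N m : ℕ} (d : ℕ) (v w : ℕ → ℕ → ℕ) (Y : Matrix (Fin N) (Fin m) ℝ) : Prop :=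
  ∀ j (c : Fin m), (c : ℕ) < 2 * d + 1 → Y j c = tokenEntry d v w j c

section Attention

variable {N d : ℕ} {u : ℕ → ℕ} {v w : ℕ → ℕ → ℕ} {j k : ℕ}

theorem attentionShare_nonneg (u : ℕ → ℕ) (j : ℕ) : 0 ≤ attentionShare N d u v w j :=
  Finset.sum_nonneg fun _ _ => softmax_nonneg _ _

theorem attentionShare_eq (hN : 0 < N) (u : ℕ → ℕ) (j : ℕ) :
    attentionShare N d u v w j = ∑ k with k ≠ (⟨0, hN⟩ : Fin N),
      softmax (fun k : Fin N => (N * agreements d u v w j k : ℝ)) k := by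
  simp only [attentionShare, ne_eq, Fin.ext_iff]

theorem agreements_eq_of_orthogonal (h : ∀ b < d, u b * v j b * w k b = 0) :
    agreements d u v w j k = agreements d u v w j 0 := by
  refine Finset.sum_congr rfl fun b hb => ?_
  rcases mul_eq_zero.1 (h b (Finset.mem_range.1 hb)) with h | h <;> simp [keyCoord, h]

theorem agreements_lt_of_not_orthogonal (hk : k ≠ 0) (h : ∃ b < d, u b * v j b * w k b ≠ 0) :
    agreements d u v w j k < agreements d u v w j 0 := by
  obtain ⟨b, hb, hne⟩ := h
  obtain ⟨huv, hw⟩ := mul_ne_zero_iff.1 hne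
  refine Finset.sum_lt_sum (fun b _ => Nat.mul_le_mul_left _ ?_) ⟨b, Finset.mem_range.2 hb, ?_⟩
  · simp only [keyCoord]
    split_ifs <;> omega
  · have hzero : 1 - w k b = 0 := by omega
    simpa [keyCoord, hk, hzero] using Nat.pos_of_ne_zero huv

theorem half_le_attentionShare (hkN : k < N) (hk : k ≠ 0)
    (h : ∀ b < d, u b * v j b * w k b = 0) : 1 / 2 ≤ attentionShare N d u v w j := by
  rw [attentionShare_eq (by omega)]
  refine half_le_sum_softmax_ne (k := ⟨k, hkN⟩) (by simpa [Fin.ext_iff] using hk) ?_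
  simp only [agreements_eq_of_orthogonal h, le_refl]

/-- The scores are multiples of `N`, so token `0` wins by a margin of at least `N`. -/
theorem attentionShare_le (h : ∀ k < N, k ≠ 0 → ∃ b < d, u b * v j b * w k b ≠ 0) :
    attentionShare N d u v w j ≤ N * Real.exp (-N) := by
  rcases Nat.eq_zero_or_pos N with rfl | hN
  · simp [attentionShare]
  rw [attentionShare_eq hN]
  refine sum_softmax_ne_le fun k hk => ?_
  have hlt : agreements d u v w j k + 1 ≤ agreements d u v w j 0 :=
    agreements_lt_of_not_orthogonal (by simpa [Fin.ext_iff] using hk)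
      (h k k.2 (by simpa [Fin.ext_iff] using hk))
  exact_mod_cast Nat.mul_le_mul_left N hlt

end Attention

section Heads

variable {N d m L H : ℕ} {u v w : ℕ → ℕ → ℕ} {Y : Matrix (Fin N) (Fin m) ℝ}

theorem query_apply (hY : CarriesTokens d v w Y) (ℓ : Fin L) (h : Fin H) (j : Fin N)
    (b : Fin m) : ((weights N d m L H u).transformer.head ℓ h).Q (Y j) b =
      if (b : ℕ) < d then (N * u (ℓ * H + h) b * v j b : ℝ) else 0 := by
  refine (vecMul_eq_of_single_entry (a := b) (Y j) fun a hab => ?_).trans ?_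
  · simp [weights, queryEntry, Fin.val_injective.ne hab]
  · by_cases hb : (b : ℕ) < d
    · rw [hY j b (by omega)]
      simp [weights, queryEntry, tokenEntry, hb, mul_comm]
    · simp [weights, queryEntry, hb]

theorem key_apply (hm : 2 * d ≤ m) (hY : CarriesTokens d v w Y) (ℓ : Fin L) (h : Fin H) (k : Fin N)
    (b : Fin m) (hb : (b : ℕ) < d) :
    ((weights N d m L H u).transformer.head ℓ h).K (Y k) b = keyCoord w k b := by
  refine (vecMul_eq_of_single_entry (a := ⟨b + d, by omega⟩) (Y k) fun a hab => ?_).trans ?_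
  · have hne : (a : ℕ) ≠ b + d := fun h => hab (Fin.ext h)
    simp [weights, keyEntry, hne]
  · have hlt : (b : ℕ) + d < 2 * d := by omega
    rw [hY k _ (by simp only; omega)]
    simp [weights, keyEntry, tokenEntry, hb, hlt]

theorem value_apply (hm : 2 * d + 1 ≤ m) (hY : CarriesTokens d v w Y) (ℓ : Fin L) (h : Fin H)
    (k : Fin N) (c : Fin m) : ((weights N d m L H u).transformer.head ℓ h).V (Y k) c =
      if (c : ℕ) = 2 * d + 1 ∧ (k : ℕ) ≠ 0 then 1 else 0 := by
  refine (vecMul_eq_of_single_entry (a := ⟨2 * d, by omega⟩) (Y k) fun a hab => ?_).trans ?_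
  · have hne : (a : ℕ) ≠ 2 * d := fun h => hab (Fin.ext h)
    simp [weights, valueEntry, hne]
  · have hlt : ¬ 2 * d < d := by omega
    rw [hY k _ (by simp)]
    by_cases hc : (c : ℕ) = 2 * d + 1 <;> by_cases hk : (k : ℕ) = 0 <;>
      simp [weights, valueEntry, tokenEntry, hlt, hc, hk]

theorem score_eq (hm : 2 * d ≤ m) (hY : CarriesTokens d v w Y) (ℓ : Fin L) (h : Fin H)
    (j k : Fin N) : ((weights N d m L H u).transformer.head ℓ h).Q (Y j) ⬝ᵥ
        ((weights N d m L H u).transformer.head ℓ h).K (Y k) =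
      N * agreements d (u (ℓ * H + h)) v w j k := by
  set summand : ℕ → ℝ := fun b =>
    if b < d then N * ((u (ℓ * H + h) b * v j b * keyCoord w k b : ℕ) : ℝ) else 0 with hsummand
  have hterm (b : Fin m) : ((weights N d m L H u).transformer.head ℓ h).Q (Y j) b *
      ((weights N d m L H u).transformer.head ℓ h).K (Y k) b = summand b := by
    simp only [query_apply hY, hsummand]
    split_ifs with hb
    · rw [key_apply hm hY ℓ h k b hb]
      push_cast
      ring
    · rw [zero_mul]
  have hfilter : (Finset.range m).filter (· < d) = Finset.range d := by
    ext b
    simp only [Finset.mem_filter, Finset.mem_range]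
    omega
  rw [dotProduct, Finset.sum_congr rfl fun b _ => hterm b, Fin.sum_univ_eq_sum_range summand m,
    ← Finset.sum_filter, hfilter, agreements, Nat.cast_sum, Finset.mul_sum]

theorem head_apply (hm : 2 * d + 1 ≤ m) (hY : CarriesTokens d v w Y) (ℓ : Fin L) (h : Fin H)
    (j : Fin N) (c : Fin m) : ((weights N d m L H u).transformer.head ℓ h).apply Y j c =
      if (c : ℕ) = 2 * d + 1 then attentionShare N d (u (ℓ * H + h)) v w j else 0 := by
  simp only [AttentionHead.apply_eq, score_eq (by omega : 2 * d ≤ m) hY, value_apply hm hY]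
  split_ifs with hc
  · simp [hc, attentionShare, Finset.sum_filter]
  · simp [hc]

theorem output_apply (hm : 2 * d + 1 ≤ m) (j : Fin N) (c : Fin m) (hc : (c : ℕ) = 2 * d + 1) :
    output N d m L H u v w j c =
      ∑ ℓ : Fin L, ∑ h : Fin H, attentionShare N d (u (ℓ * H + h)) v w j := by
  set D : Fin L → Matrix (Fin N) (Fin m) ℝ := fun ℓ => Matrix.of fun j c =>
    if (c : ℕ) = 2 * d + 1 then ∑ h : Fin H, attentionShare N d (u (ℓ * H + h)) v w j else 0
    with hD
  have hlayer (ℓ : Fin L) (Y : Matrix (Fin N) (Fin m) ℝ) (hY : CarriesTokens d v w Y) :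
      (weights N d m L H u).transformer.layer ℓ Y = Y + D ℓ := by
    ext j c
    rw [Weights.layer_transformer, Matrix.add_apply, Matrix.sum_apply]
    simp only [head_apply hm hY, hD, Matrix.add_apply, Matrix.of_apply]
    split_ifs <;> simp
  have hcarries (ℓ : Fin L) (Y : Matrix (Fin N) (Fin m) ℝ) (hY : CarriesTokens d v w Y) :
      CarriesTokens d v w (Y + D ℓ) := fun j c hc => by
    simp [hD, hY j c hc, hc.ne]
  have htokens : CarriesTokens d v w ((tokens N d m v w).map (fun r : ℚ => (r : ℝ))) :=
    fun j c _ => by simp [tokens]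
  have hzero : tokenEntry d v w j (2 * d + 1) = 0 := by
    rw [tokenEntry, if_neg (by omega), if_neg (by omega), if_neg (by omega)]
  rw [output, Weights.eval_transformer_eq_add_sum hlayer hcarries htokens]
  simp [hD, tokens, Matrix.sum_apply, hc, hzero]

theorem attentionShare_le_output (hm : 2 * d + 1 ≤ m) (j : Fin N) (c : Fin m)
    (hc : (c : ℕ) = 2 * d + 1) (ℓ : Fin L) (h : Fin H) :
    attentionShare N d (u (ℓ * H + h)) v w j ≤ output N d m L H u v w j c := by
  rw [output_apply hm j c hc]
  refine (Finset.single_le_sum (fun h _ => ?_) (Finset.mem_univ h)).trans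
    (Finset.single_le_sum
      (f := fun ℓ : Fin L => ∑ h : Fin H, attentionShare N d (u (ℓ * H + h)) v w j)
      (fun ℓ _ => Finset.sum_nonneg fun h _ => ?_) (Finset.mem_univ ℓ))
  all_goals exact attentionShare_nonneg _ _

theorem half_le_output (hm : 2 * d + 1 ≤ m) (j : Fin N) (c : Fin m) (hc : (c : ℕ) = 2 * d + 1)
    (hj : InOrthogonalTriple N d (L * H) u v w j) : 1 / 2 ≤ output N d m L H u v w j c := by
  obtain ⟨r, hr, k, hkN, hk, horth⟩ := hj
  have hH : 0 < H := Nat.pos_of_ne_zero fun h => by simp [h] at hr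
  have hrL : r / H < L := (Nat.div_lt_iff_lt_mul hH).2 hr
  refine (half_le_attentionShare hkN hk horth).trans ?_
  have hle := attentionShare_le_output (u := u) (v := v) (w := w) hm j c hc ⟨r / H, hrL⟩
    ⟨r % H, Nat.mod_lt r hH⟩
  rwa [Nat.div_add_mod'] at hle

theorem output_le (hm : 2 * d + 1 ≤ m) (j : Fin N) (c : Fin m) (hc : (c : ℕ) = 2 * d + 1)
    (hj : ¬ InOrthogonalTriple N d (L * H) u v w j) :
    output N d m L H u v w j c ≤ L * H * (N * Real.exp (-N)) := by
  have hshare (ℓ : Fin L) (h : Fin H) :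
      attentionShare N d (u (ℓ * H + h)) v w j ≤ N * Real.exp (-N) := by
    refine attentionShare_le fun k hkN hk => ?_
    by_contra! horth
    refine hj ⟨ℓ * H + h, ?_, k, hkN, hk, horth⟩
    calc (ℓ : ℕ) * H + h < (ℓ + 1) * H := by rw [add_mul, one_mul]; omega
      _ ≤ L * H := Nat.mul_le_mul_right _ ℓ.2
  rw [output_apply hm j c hc]
  refine (Finset.sum_le_sum fun ℓ _ => Finset.sum_le_sum fun h _ => hshare ℓ h).trans ?_
  simp [mul_assoc]

end Heads

section Bounded

variable {N d m L H B : ℕ} {u v w : ℕ → ℕ → ℕ}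

theorem ratBounded_natCast {x : ℕ} (hB : 1 ≤ B) (hx : x ≤ B) : RatBounded B (x : ℚ) :=
  ⟨by simpa using hx, by simpa using hB⟩

theorem weights_bounded (hNB : N ≤ B) (hB : 1 ≤ B) (hu : ∀ r b, u r b ≤ 1) :
    (weights N d m L H u).Bounded B := by
  refine fun ℓ h a b =>
    ⟨ratBounded_natCast hB ?_, ratBounded_natCast hB ?_, ratBounded_natCast hB ?_⟩
  · unfold queryEntry
    split_ifs
    · exact (Nat.mul_le_mul_left N (hu _ _)).trans (by simpa using hNB)
    · exact B.zero_le
  · unfold keyEntry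
    split_ifs <;> omega
  · unfold valueEntry
    split_ifs <;> omega

theorem tokens_bounded (hB : 1 ≤ B) (hv : ∀ j b, v j b ≤ 1) (j : Fin N) (c : Fin m) :
    RatBounded B (tokens N d m v w j c) := by
  refine ratBounded_natCast hB (le_trans ?_ hB)
  unfold tokenEntry keyCoord
  split_ifs <;> first | exact hv _ _ | omega

end Bounded

end OrthogonalityGadget

/-! ## Memory layout of the reduction -/

namespace OVReduction

/-- The parameters of a 3-OV instance and of the transformers that it is reduced to. -/
structure Params where
  (n d N m L H : ℕ)

namespace Params

variable (π : Params)

/-- The number of blocks that the second and the third family are divided into. A block has `N - 1`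
vectors, since token `0` carries none. -/
def B : ℕ := π.n / (π.N - 1) + 1

/-- The number of transformers: there is one for each group of `L * H` vectors of the first family
and each pair of blocks of the other two. -/
def M : ℕ := (π.n / (π.L * π.H) + 1) * (π.B * π.B)

/-- The number of entries of the tokens. -/
abbrev tokenCount : ℕ := π.N * π.m

/-- The number of entries of all query matrices. -/
abbrev weightCount : ℕ := π.L * (π.H * (π.m * π.m))

/-- The contents of array `6` while transformer `i` is processed; `t` is the loop counter, and `r`
is nonzero if an orthogonal triple has been found. -/
def registers (i t r : ℕ) : ℕ → ℕ
  | 0 => π.M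
  | 1 => i
  | 2 => π.N
  | 3 => π.m
  | 4 => π.L
  | 5 => π.H
  | 6 => π.B
  | 7 => t
  | 8 => r
  | _ => 0

theorem update_registers_counter (i t r y : ℕ) :
    Function.update (π.registers i t r) 7 y = π.registers i y r := by
  ext x
  rw [Function.update_apply]
  split_ifs with hx
  · rw [hx]; rfl
  · unfold registers; split <;> first | rfl | exact absurd rfl hx

theorem update_registers_answer (i t r y : ℕ) :
    Function.update (π.registers i t r) 8 y = π.registers i t y := by
  ext x
  rw [Function.update_apply]
  split_ifs with hx
  · rw [hx]; rfl
  · unfold registers; split <;> first | rfl | exact absurd rfl hx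

theorem update_registers_index (i t r y : ℕ) :
    Function.update (π.registers i t r) 1 y = π.registers y t r := by
  ext x
  rw [Function.update_apply]
  split_ifs with hx
  · rw [hx]; rfl
  · unfold registers; split <;> first | rfl | exact absurd rfl hx

end Params

/-- The array that holds the simulated array `a`, of the algorithm that computes the parameters for
`k = 8`, and of the algorithm that computes transformers for `k = 9`. -/
def bank (k a : ℕ) : ℕ := 2 * a + k

theorem bank_injective (k : ℕ) : (bank k).Injective := fun a b h => by
  simp only [bank] at h
  omega

theorem bank_ne {k x : ℕ} (hx : x < k) (a : ℕ) : bank k a ≠ x := by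
  simp only [bank]
  omega

/-- The numbers that the reduction handles have at most `β` bits. -/
structure Fits (π : Params) (inp : State) (β : ℕ) : Prop where
  pos : 1 ≤ β
  n_eq : inp 0 0 = π.n
  d_eq : inp 0 1 = π.d
  input_size : ∀ a < 4, ∀ x, (inp a x).size ≤ β
  M_size : π.M.size ≤ β
  N_size : π.N.size ≤ β
  m_size : π.m.size ≤ β
  L_size : π.L.size ≤ β
  H_size : π.H.size ≤ β
  B_size : π.B.size ≤ β
  tokenCount_size : π.tokenCount.size ≤ β
  weightCount_size : π.weightCount.size ≤ β

/-- The state between two transformers: the parts `i, i + 1, …` of the memory for the algorithm that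
computes transformers have not been used. -/
structure Ready (π : Params) (inp : State) (β i r : ℕ) (s : State) : Prop where
  register : ∃ t, t.size ≤ β ∧ s 6 = π.registers i t r
  index_le : i ≤ π.M
  answer_le : r ≤ 1
  input : ∀ a < 4, s a = inp a
  fresh : ∀ a x, i ≤ x % π.M → s (bank 9 a) x = 0

/-- The state while transformer `i` is processed, where `v` is the memory of the algorithm that
computes transformers. -/
structure Work (π : Params) (inp : State) (β i t r : ℕ) (v s : State) : Prop where
  part_lt : i < π.M
  register : s 6 = π.registers i t r
  counter_size : t.size ≤ β
  answer_le : r ≤ 1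
  input : ∀ a < 4, s a = inp a
  cell : ∀ a x, s (bank 9 a) (x * π.M + i) = v a x
  fresh : ∀ a x, i + 1 ≤ x % π.M → s (bank 9 a) x = 0

section Work

variable {π : Params} {inp : State} {β i t t' r r' : ℕ} {s s' v v' : State}

theorem Ready.work (h : Ready π inp β i r s) (hi : i < π.M) :
    ∃ t, Work π inp β i t r (fun _ _ => 0) s := by
  obtain ⟨t, ht, hreg⟩ := h.register
  refine ⟨t, hi, hreg, ht, h.answer_le, h.input, fun a x => h.fresh a _ ?_,
    fun a x hx => h.fresh a x (by omega)⟩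
  rw [Nat.mul_add_mod', Nat.mod_eq_of_lt hi]

namespace Work

theorem simulates (h : Work π inp β i t r v s) :
    Simulates (bank 9) s (π.registers i t r) v s :=
  ⟨h.part_lt, h.register, h.cell, fun _ _ _ _ => rfl⟩

theorem of_simulates (h : Work π inp β i t r v s)
    (h' : Simulates (bank 9) s (π.registers i t' r') v' s') (ht' : t'.size ≤ β) (hr' : r' ≤ 1) :
    Work π inp β i t' r' v' s' where
  part_lt := h.part_lt
  register := h'.register
  counter_size := ht'
  answer_le := hr'
  input a ha := (funext fun x => h'.frame a x (by omega)
    (.inl fun b => (bank_ne (by omega) b).symm)).trans (h.input a ha)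
  cell := h'.cell
  fresh a x hx := by
    rw [h'.frame (bank 9 a) x (bank_ne (by norm_num) a) (.inr (Nat.ne_of_gt hx)), h.fresh a x hx]

theorem size_le (h : Work π inp β i t r v s) (hf : Fits π inp β) {a : ℕ} (ha : a < 4 ∨ a = 6)
    (x : ℕ) : (s a x).size ≤ β := by
  rcases ha with ha | rfl
  · rw [h.input a ha]
    exact hf.input_size a ha x
  · have hr : r.size ≤ 1 := (Nat.size_le_size h.answer_le).trans_eq Nat.size_one
    have hi := Nat.size_le_size h.part_lt.le
    have := h.counter_size
    obtain ⟨hβ, -, -, -, hM, hN, hm, hL, hH, hB, -, -⟩ := hf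
    rw [h.register]
    unfold Params.registers
    split <;> first | omega | simp

theorem store_bank (h : Work π inp β i t r v s) (hf : Fits π inp β) (a : ℕ) {x y : Expr}
    (hx : x.BoundedReads s β) (hy : y.BoundedReads s β) :
    Runs (.store (bank 9 a) x.addr y) s β
      (Work π inp β i t r (v.write a (x.eval s) (y.eval s))) :=
  (h.simulates.store (bank_injective 9) (bank_ne (by norm_num)) hf.pos hf.M_size a hx hy).mono
    le_rfl fun _ h' => h.of_simulates h' h.counter_size h.answer_le

theorem store_counter (h : Work π inp β i t r v s) {T : ℕ} (hT : 1 ≤ T) {y : Expr}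
    (hy : y.BoundedReads s T) (ht' : (y.eval s).size ≤ β) :
    Runs (.store 6 7 y) s T (Work π inp β i (y.eval s) r v) :=
  (h.simulates.store_register (bank_ne (by norm_num)) hT (x := 7) trivial (by simp) hy).mono le_rfl
    fun _ h' => h.of_simulates (by simpa [Params.update_registers_counter] using h') ht' h.answer_le

theorem store_answer (h : Work π inp β i t r v s) {T : ℕ} (hT : 1 ≤ T) :
    Runs (.store 6 8 1) s T (Work π inp β i t 1 v) :=
  (h.simulates.store_register (bank_ne (by norm_num)) hT (x := 8) (y := 1) trivial (by simp)
    trivial).mono le_rfl fun _ h' => h.of_simulates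
      (by simpa [Params.update_registers_answer] using h') h.counter_size le_rfl

end Work

end Work

/-! ## Writing the input of a transformer -/

/-- The array of the codes of `F 0, …, F (b - 1)`. -/
def codeArray (F : ℕ → ℕ) (b x : ℕ) : ℕ :=
  if x / 3 < b then (if x % 3 = 0 then F (x / 3) else if x % 3 = 2 then 1 else 0) else 0

theorem ratArray_natCast {b : ℕ} (F : ℕ → ℕ) :
    ratArray (fun p : Fin b => (F p : ℚ)) = codeArray F b := by
  ext x
  have hcode (y : ℕ) (i : Fin 3) :
      ratCode (y : ℚ) i = if (i : ℕ) = 0 then y else if (i : ℕ) = 2 then 1 else 0 := by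
    fin_cases i <;> simp [ratCode]
  simp only [ratArray, codeArray, hcode, dite_eq_ite]

theorem codeArray_succ (F : ℕ → ℕ) (t x : ℕ) : codeArray F (t + 1) x =
    if x = 3 * t + 2 then 1 else if x = 3 * t then F t else codeArray F t x := by
  obtain ⟨q, c, hc, rfl⟩ : ∃ q c, c < 3 ∧ x = 3 * q + c :=
    ⟨x / 3, x % 3, Nat.mod_lt x (by norm_num), (Nat.div_add_mod x 3).symm⟩
  have hdiv : (3 * q + c) / 3 = q := by omega
  have hmod : (3 * q + c) % 3 = c := by omega
  simp only [codeArray, hdiv, hmod]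
  rcases lt_trichotomy q t with h | rfl | h
  · have h₁ : 3 * q + c ≠ 3 * t + 2 := by omega
    have h₂ : 3 * q + c ≠ 3 * t := by omega
    simp only [if_pos (h.trans t.lt_succ_self), if_neg h₁, if_neg h₂, if_pos h]
  · interval_cases c <;> simp
  · have h₁ : 3 * q + c ≠ 3 * t + 2 := by omega
    have h₂ : 3 * q + c ≠ 3 * t := by omega
    simp only [if_neg h₁, if_neg h₂, if_neg h.not_gt, if_neg (show ¬ q < t + 1 by omega)]

theorem write_codeArray (v : State) (a t : ℕ) (F : ℕ → ℕ) :
    State.write (State.write (Function.update v a (codeArray F t)) a (3 * t) (F t))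
        a (3 * t + 2) 1 =
      Function.update v a (codeArray F (t + 1)) := by
  ext b x
  by_cases hb : b = a
  · subst hb
    simp [State.write, codeArray_succ]
  · simp [State.write, hb]

theorem ratArray_rowMajor {a b : ℕ} (F : ℕ → ℕ → ℕ) :
    ratArray (rowMajor fun (i : Fin a) (j : Fin b) => (F i j : ℚ)) =
      codeArray (fun t => F (t / b) (t % b)) (a * b) :=
  ratArray_natCast fun t => F (t / b) (t % b)

theorem ratArray_flattenWeights {m L H : ℕ} (F : ℕ → ℕ → ℕ → ℕ) :
    ratArray (flattenWeights fun (ℓ : Fin L) (h : Fin H) =>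
        (Matrix.of fun (a b : Fin m) => (F (ℓ * H + h) a b : ℚ))) =
      codeArray (fun t => F (t / (m * m)) (t / m % m) (t % m)) (L * (H * (m * m))) := by
  rw [← ratArray_natCast]
  congr 1
  ext p
  have hhead (x K : ℕ) : x / (H * K) * H + x / K % H = x / K := by
    rw [mul_comm H, ← Nat.div_div_eq_div_mul, Nat.div_add_mod']
  simp only [flattenWeights, rowMajor, Fin.coe_divNat, Fin.coe_modNat, Matrix.of_apply,
    Nat.mod_mul_left_div_self, Nat.mod_mul_left_mod, hhead]

namespace Params

variable (π : Params) (inp : State) (i : ℕ)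

/-- The vectors of the first family that are given to the heads of transformer `i`. The indices wrap
around at the end of the family. -/
def headVec (h c : ℕ) : ℕ := inp 1 ((i / (π.B * π.B) * (π.L * π.H) + h) % π.n * π.d + c)

/-- The vectors of the second family that are given to the tokens of transformer `i`. -/
def rowVec (j c : ℕ) : ℕ := inp 2 ((i / π.B % π.B * (π.N - 1) + (j - 1)) % π.n * π.d + c)

/-- The vectors of the third family that are given to the tokens of transformer `i`. -/
def colVec (j c : ℕ) : ℕ := inp 3 ((i % π.B * (π.N - 1) + (j - 1)) % π.n * π.d + c)

/-- The weights of transformer `i`. -/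
def weights : Weights π.m π.L π.H :=
  OrthogonalityGadget.weights π.N π.d π.m π.L π.H (π.headVec inp i)

/-- The input of transformer `i`. -/
def tokens : Matrix (Fin π.N) (Fin π.m) ℚ :=
  OrthogonalityGadget.tokens π.N π.d π.m (π.rowVec inp i) (π.colVec inp i)

/-- Token `j` of transformer `i` belongs to an orthogonal triple. -/
def Hit (j : ℕ) : Prop :=
  OrthogonalityGadget.InOrthogonalTriple π.N π.d (π.L * π.H) (π.headVec inp i) (π.rowVec inp i)
    (π.colVec inp i) j

end Params

/-- While transformer `i` is processed, the expression reads numbers of at most `β` bits, and its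
value is `F t` if the loop counter is `t`. -/
def Represents (π : Params) (inp : State) (β i : ℕ) (e : Expr) (F : ℕ → ℕ) : Prop :=
  ∀ t r v s, Work π inp β i t r v s → e.BoundedReads s β ∧ e.eval s = F t

/-! The expressions below read the registers, and the position in a matrix that the counter `t`
stands for: row `t / m % m` and column `t % m` of head `t / (m * m)`, or entry `t % m` of token
`t / m`. -/

namespace Code

def n : Expr := .load 0 0
def d : Expr := .load 0 1
def M : Expr := .load 6 0
def index : Expr := .load 6 1
def N : Expr := .load 6 2
def m : Expr := .load 6 3
def L : Expr := .load 6 4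
def H : Expr := .load 6 5
def B : Expr := .load 6 6
def counter : Expr := .load 6 7
def answer : Expr := .load 6 8
def tokenCount : Expr := N * m
def weightCount : Expr := L * (H * (m * m))
def head : Expr := counter / (m * m)
def row : Expr := .mod (counter / m) m
def token : Expr := counter / m
def col : Expr := .mod counter m

def headVec : Expr := .load 1 (.mod (index / (B * B) * (L * H) + head) n * d + row)

def rowVec : Expr := .load 2 (.mod (.mod (index / B) B * (N - 1) + (token - 1)) n * d + col)

def colVec : Expr := .load 3 (.mod (.mod index B * (N - 1) + (token - 1)) n * d + (col - d))

def tokenEntry : Expr :=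
  .lt col d * rowVec + (1 - .lt col d) * .lt col (2 * d) * (1 - .lt 0 token * colVec) +
    .eq col (2 * d) * .lt 0 token

def queryEntry : Expr := .lt row d * .eq row col * (N * headVec)
def keyEntry : Expr := .lt col d * .eq row (col + d)
def valueEntry : Expr := .eq col (2 * d + 1) * .eq row (2 * d)

end Code

section Represents

variable {π : Params} {inp : State} {β : ℕ}

theorem represents_tokenCount (hf : Fits π inp β) (i : ℕ) :
    Represents π inp β i Code.tokenCount fun _ => π.tokenCount :=
  fun t r v s h => by
    simp [Code.tokenCount, Code.N, Code.m, h.register, Params.registers, hf.N_size, hf.m_size]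

theorem represents_weightCount (hf : Fits π inp β) (i : ℕ) :
    Represents π inp β i Code.weightCount fun _ => π.weightCount :=
  fun t r v s h => by
    simp [Code.weightCount, Code.L, Code.H, Code.m, h.register, Params.registers, hf.L_size,
      hf.H_size, hf.m_size]

theorem represents_tokenEntry (hf : Fits π inp β) (i : ℕ) :
    Represents π inp β i Code.tokenEntry fun t =>
      OrthogonalityGadget.tokenEntry π.d (π.rowVec inp i) (π.colVec inp i) (t / π.m) (t % π.m) := by
  intro t r v s h
  constructor
  · simp [Code.tokenEntry, Code.col, Code.token, Code.rowVec, Code.colVec, Code.index, Code.counter,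
      Code.n, Code.d, Code.N, Code.m, Code.B, h.size_le hf]
  · simp [Code.tokenEntry, Code.col, Code.token, Code.rowVec, Code.colVec, Code.index, Code.counter,
      Code.n, Code.d, Code.N, Code.m, Code.B, h.register, Params.registers, h.input, hf.n_eq,
      hf.d_eq, OrthogonalityGadget.tokenEntry_eq, Params.rowVec, Params.colVec]

theorem represents_queryEntry (hf : Fits π inp β) (i : ℕ) :
    Represents π inp β i Code.queryEntry fun t =>
      OrthogonalityGadget.queryEntry π.N π.d (π.headVec inp i (t / (π.m * π.m))) (t / π.m % π.m)
        (t % π.m) := by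
  intro t r v s h
  constructor
  · simp [Code.queryEntry, Code.col, Code.row, Code.head, Code.headVec, Code.index, Code.counter,
      Code.n, Code.d, Code.N, Code.m, Code.L, Code.H, Code.B, h.size_le hf]
  · simp [Code.queryEntry, Code.col, Code.row, Code.head, Code.headVec, Code.index, Code.counter,
      Code.n, Code.d, Code.N, Code.m, Code.L, Code.H, Code.B, h.register, Params.registers, h.input,
      hf.n_eq, hf.d_eq, OrthogonalityGadget.queryEntry, Params.headVec, ite_and]

theorem represents_keyEntry (hf : Fits π inp β) (i : ℕ) :
    Represents π inp β i Code.keyEntry fun t =>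
      OrthogonalityGadget.keyEntry π.d (t / π.m % π.m) (t % π.m) := by
  intro t r v s h
  constructor
  · simp [Code.keyEntry, Code.col, Code.row, Code.counter, Code.d, Code.m, h.size_le hf]
  · simp [Code.keyEntry, Code.col, Code.row, Code.counter, Code.d, Code.m, h.register,
      Params.registers, h.input, hf.d_eq, OrthogonalityGadget.keyEntry, ite_and]

theorem represents_valueEntry (hf : Fits π inp β) (i : ℕ) :
    Represents π inp β i Code.valueEntry fun t =>
      OrthogonalityGadget.valueEntry π.d (t / π.m % π.m) (t % π.m) := by
  intro t r v s h
  constructor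
  · simp [Code.valueEntry, Code.col, Code.row, Code.counter, Code.d, Code.m, h.size_le hf]
  · simp [Code.valueEntry, Code.col, Code.row, Code.counter, Code.d, Code.m, h.register,
      Params.registers, h.input, hf.d_eq, OrthogonalityGadget.valueEntry, ite_and]

end Represents

/-- Write the codes of `b` numbers into array `a` of the simulated memory, where `e` is the number
at the position that is given by the counter. -/
def fill (a : ℕ) (b e : Expr) : Prog :=
  .seq (.store 6 7 0) <| .loop (b - Code.counter) <|
    .seq (.store (bank 9 a) (3 * Code.counter).addr e) <|
      .seq (.store (bank 9 a) (3 * Code.counter + 2).addr 1) (.store 6 7 (Code.counter + 1))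

/-- Write the input of a transformer. -/
def prepare : Prog :=
  .seq (.store (bank 9 0) (0 : Expr).addr Code.N) <|
  .seq (.store (bank 9 0) (1 : Expr).addr Code.m) <|
  .seq (.store (bank 9 0) (2 : Expr).addr Code.L) <|
  .seq (.store (bank 9 0) (3 : Expr).addr Code.H) <|
  .seq (fill 1 Code.tokenCount Code.tokenEntry) <|
  .seq (fill 2 Code.weightCount Code.queryEntry) <|
  .seq (fill 3 Code.weightCount Code.keyEntry) (fill 4 Code.weightCount Code.valueEntry)

section Prepare

variable {π : Params} {inp : State} {β i t r : ℕ} {s v : State}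

theorem Work.eval_counter (h : Work π inp β i t r v s) : Code.counter.eval s = t := by
  simp [Code.counter, h.register, Params.registers]

theorem Work.boundedReads_counter (h : Work π inp β i t r v s) (hf : Fits π inp β) :
    Code.counter.BoundedReads s β :=
  ⟨h.size_le hf (.inr rfl) _, trivial⟩

theorem Work.fill (h : Work π inp β i t r v s) (hf : Fits π inp β) {a : ℕ} (ha : v a = fun _ => 0)
    {b : ℕ} (hb : b.size ≤ β) {bound e : Expr} {F : ℕ → ℕ}
    (hbound : Represents π inp β i bound fun _ => b) (he : Represents π inp β i e F) :
    Runs (fill a bound e) s (β * (b + 1))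
      (Work π inp β i b r (Function.update v a (codeArray F b))) := by
  have hzero : Function.update v a (codeArray F 0) = v :=
    (congrArg _ (funext fun x => by simp [codeArray, ha])).trans (Function.update_eq_self a v)
  have hstart := h.store_counter hf.pos (y := 0) trivial (by simp)
  refine (hstart.mono (Nat.le_mul_of_pos_right _ b.succ_pos) fun _ => id).seq fun s h =>
    Runs.loop_const (fun t => Work π inp β i t r (Function.update v a (codeArray F t))) hf.pos b
      ?_ ?_ ?_ (by rwa [hzero])
  · exact fun t s h => ⟨(hbound t r _ s h).1, h.boundedReads_counter hf⟩
  · intro t s htb h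
    have hcounter := h.boundedReads_counter hf
    refine ⟨by simp [(hbound t r _ s h).2, h.eval_counter]; omega, ?_⟩
    refine (h.store_bank hf a (x := 3 * Code.counter) (by simp [hcounter]) (he t r _ s h).1).seq
      fun s₁ h₁ => (h₁.store_bank hf a (x := 3 * Code.counter + 2) (y := 1)
        (by simp [h₁.boundedReads_counter hf]) trivial).seq fun s₂ h₂ => ?_
    have hsucc : (Code.counter + 1).eval s₂ = t + 1 := by simp [h₂.eval_counter]
    have hwrite := write_codeArray v a t F
    simp only [Expr.eval_mul, Expr.eval_add, Expr.eval_ofNat, h.eval_counter, h₁.eval_counter,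
      (he t r _ s h).2, hwrite] at h₂
    have hstep := h₂.store_counter hf.pos (y := Code.counter + 1)
      (by simp [h₂.boundedReads_counter hf])
      (hsucc ▸ (Nat.size_le_size htb).trans hb)
    rwa [hsucc] at hstep
  · intro s h
    simp [(hbound b r _ s h).2, h.eval_counter]

theorem transformerInput_eq : transformerInput (π.weights inp i) (π.tokens inp i) =
    Function.update (Function.update (Function.update (Function.update
      (State.write (State.write (State.write (State.write (fun _ _ => 0) 0 0 π.N) 0 1 π.m) 0 2 π.L)
        0 3 π.H)
      1 (codeArray (fun t => OrthogonalityGadget.tokenEntry π.d (π.rowVec inp i) (π.colVec inp i)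
          (t / π.m) (t % π.m)) π.tokenCount))
      2 (codeArray (fun t => OrthogonalityGadget.queryEntry π.N π.d
          (π.headVec inp i (t / (π.m * π.m))) (t / π.m % π.m) (t % π.m)) π.weightCount))
      3 (codeArray (fun t => OrthogonalityGadget.keyEntry π.d (t / π.m % π.m) (t % π.m))
          π.weightCount))
      4 (codeArray (fun t => OrthogonalityGadget.valueEntry π.d (t / π.m % π.m) (t % π.m))
          π.weightCount) := by
  funext a
  rcases a with _ | _ | _ | _ | _ | a
  · ext x
    rcases lt_or_ge x 4 with hx | hx
    · interval_cases x <;> simp [transformerInput, State.write, natArray]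
    · have hne : x ≠ 0 ∧ x ≠ 1 ∧ x ≠ 2 ∧ x ≠ 3 := by omega
      simp [transformerInput, State.write, natArray, hx.not_gt, hne]
  · simpa [transformerInput, Params.tokens, OrthogonalityGadget.tokens] using
      ratArray_rowMajor (OrthogonalityGadget.tokenEntry π.d (π.rowVec inp i) (π.colVec inp i))
  · simpa [transformerInput, Params.weights, OrthogonalityGadget.weights] using
      ratArray_flattenWeights fun h => OrthogonalityGadget.queryEntry π.N π.d (π.headVec inp i h)
  · simpa [transformerInput, Params.weights, OrthogonalityGadget.weights] using
      ratArray_flattenWeights fun _ => OrthogonalityGadget.keyEntry π.d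
  · simpa [transformerInput, Params.weights, OrthogonalityGadget.weights] using
      ratArray_flattenWeights fun _ => OrthogonalityGadget.valueEntry π.d
  · ext x
    simp [transformerInput, State.write]

theorem Work.prepare (h : Work π inp β i t r (fun _ _ => 0) s) (hf : Fits π inp β) :
    Runs prepare s (β * (π.tokenCount + π.weightCount + 1))
      (Work π inp β i π.weightCount r (transformerInput (π.weights inp i) (π.tokens inp i))) := by
  have hstore (x k : ℕ) {t v s} (h : Work π inp β i t r v s) :
      Runs (.store (bank 9 0) (Expr.lit x).addr (.load 6 (.lit k))) s
        (β * (π.tokenCount + π.weightCount + 1))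
        (Work π inp β i t r (State.write v 0 x (π.registers i t r k))) :=
    (h.store_bank hf 0 (x := .lit x) (y := .load 6 (.lit k)) trivial
        ⟨h.size_le hf (.inr rfl) _, trivial⟩).mono
      (Nat.le_mul_of_pos_right _ (Nat.succ_pos _)) fun _ h' => by
        simpa only [Expr.eval_load, Expr.eval, h.register] using h'
  have hfill (a : ℕ) {e : Expr} {F : ℕ → ℕ} (he : Represents π inp β i e F) {t v s}
      (h : Work π inp β i t r v s) (ha : v a = fun _ => 0) :
      Runs (OVReduction.fill a Code.weightCount e) s (β * (π.tokenCount + π.weightCount + 1))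
        (Work π inp β i π.weightCount r (Function.update v a (codeArray F π.weightCount))) :=
    (h.fill hf ha hf.weightCount_size (represents_weightCount hf i) he).mono
      (Nat.mul_le_mul_left _ (by omega)) fun _ => id
  rw [transformerInput_eq]
  refine (hstore 0 2 h).seq fun s₁ h₁ => (hstore 1 3 h₁).seq fun s₂ h₂ =>
    (hstore 2 4 h₂).seq fun s₃ h₃ => (hstore 3 5 h₃).seq fun s₄ h₄ =>
    ((h₄.fill hf (a := 1) ?_ hf.tokenCount_size (represents_tokenCount hf i)
      (represents_tokenEntry hf i)).mono (Nat.mul_le_mul_left _ (by omega)) fun _ => id).seq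
    fun s₅ h₅ => (hfill 2 (represents_queryEntry hf i) h₅ ?_).seq fun s₆ h₆ =>
    (hfill 3 (represents_keyEntry hf i) h₆ ?_).seq fun s₇ h₇ =>
    hfill 4 (represents_valueEntry hf i) h₇ ?_
  all_goals
    ext x
    simp [State.write]

end Prepare

/-! ## Reading the output of a transformer -/

/-- The address of part `q` of the output entry that decides on token `j`. -/
def Params.outAddr (π : Params) (q j : ℕ) : ℕ := 3 * (j * π.m + (2 * π.d + 1)) + q

/-- The decisive output entry of token `j` is greater than `1 / 4`. -/
def Accepts (π : Params) (v : State) (j : ℕ) : Prop :=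
  4 * v 5 (π.outAddr 1 j) + v 5 (π.outAddr 2 j) < 4 * v 5 (π.outAddr 0 j)

namespace Code

/-- Part `q` (positive part, negative part or denominator) of the output entry that decides on the
current token. -/
def output (q : Expr) : Expr := .load (bank 9 5) (3 * (counter * m + (2 * d + 1)) + q).addr

/-- The test of `Accepts`, multiplied out so that nothing is divided or truncated. -/
def test : Expr := .lt (4 * output 1 + output 2) (4 * output 0)

end Code

/-- Set the answer to `1` if some token is accepted. -/
def scan : Prog :=
  .seq (.store 6 7 1) <| .loop (Code.N - Code.counter) <|
    .seq (.ite Code.test (.store 6 8 1) .skip) (.store 6 7 (Code.counter + 1))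

section Scan

variable {π : Params} {inp : State} {β i t r : ℕ} {s v : State}

theorem Params.outAddr_injective (hm : 0 < π.m) (q : ℕ) : (π.outAddr q).Injective := fun a b h => by
  have : a * π.m = b * π.m := by simp only [outAddr] at h; omega
  exact Nat.eq_of_mul_eq_mul_right hm this

/-- The number of bits of the numbers that the test of token `j` reads from the output. -/
def outSize (π : Params) (v : State) (j : ℕ) : ℕ :=
  (v 5 (π.outAddr 0 j)).size + (v 5 (π.outAddr 1 j)).size + (v 5 (π.outAddr 2 j)).size

theorem sum_outSize_le (hm : 0 < π.m) {τ : ℕ} (hv : ∀ F : Finset ℕ, ∑ x ∈ F, (v 5 x).size ≤ τ)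
    (F : Finset ℕ) : ∑ j ∈ F, outSize π v j ≤ 3 * τ := by
  have hpart (q : ℕ) : ∑ j ∈ F, (v 5 (π.outAddr q j)).size ≤ τ :=
    (Finset.sum_map F ⟨_, Params.outAddr_injective hm q⟩ fun x => (v 5 x).size).symm.trans_le (hv _)
  simp only [outSize, Finset.sum_add_distrib]
  linarith [hpart 0, hpart 1, hpart 2]

theorem Work.eval_test (h : Work π inp β i t r v s) (hf : Fits π inp β) :
    Code.test.eval s ≠ 0 ↔ Accepts π v t := by
  simp [Code.test, Code.output, Code.counter, Code.m, Code.d, h.register, Params.registers, h.input,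
    hf.d_eq, Accepts, h.cell, Params.outAddr]

theorem Work.boundedReads_test (h : Work π inp β i t r v s) (hf : Fits π inp β) :
    Code.test.BoundedReads s (β + outSize π v t) := by
  have hsmall {a : ℕ} (ha : a < 4 ∨ a = 6) (x : ℕ) : (s a x).size ≤ β + outSize π v t :=
    (h.size_le hf ha x).trans (Nat.le_add_right _ _)
  have houtput {q : Expr} (hq : q.BoundedReads s (β + outSize π v t)) {x : ℕ} (hx : q.eval s = x)
      (hsize : (v 5 (π.outAddr x t)).size ≤ outSize π v t) :
      (Code.output q).BoundedReads s (β + outSize π v t) := by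
    have hload : (Code.output q).eval s = v 5 (π.outAddr x t) := by
      simp [Code.output, Code.counter, Code.m, Code.d, h.register, Params.registers, h.input,
        hf.d_eq, h.cell, Params.outAddr, hx]
    refine ⟨(congrArg Nat.size hload).trans_le (hsize.trans (Nat.le_add_left _ _)), ?_⟩
    simp [Code.counter, Code.m, Code.d, Expr.addr, hsmall, hq]
  simp only [Code.test, Expr.boundedReads_lt, Expr.boundedReads_add, Expr.boundedReads_mul,
    Expr.boundedReads_ofNat, true_and]
  unfold outSize at houtput ⊢
  exact ⟨⟨houtput (x := 1) trivial rfl (by omega), houtput (x := 2) trivial rfl (by omega)⟩,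
    houtput (x := 0) trivial rfl (by omega)⟩

theorem Work.scan_step (h : Work π inp β i t r v s) (hf : Fits π inp β) (ht : t < π.N) :
    Runs (.seq (.ite Code.test (.store 6 8 1) .skip) (.store 6 7 (Code.counter + 1))) s
      (β + outSize π v t) fun s' => ∃ r', Work π inp β i (t + 1) r' v s' ∧
        (r' ≠ 0 ↔ r ≠ 0 ∨ Accepts π v t) := by
  have hT : 1 ≤ β + outSize π v t := hf.pos.trans (Nat.le_add_right _ _)
  have htest : Runs (.ite Code.test (.store 6 8 1) .skip) s (β + outSize π v t) fun s' =>
      ∃ r', Work π inp β i t r' v s' ∧ (r' ≠ 0 ↔ r ≠ 0 ∨ Accepts π v t) := by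
    refine Runs.ite hT (h.boundedReads_test hf) (fun haccept => ?_) fun hreject =>
      Runs.skip hT ⟨r, h, ?_⟩
    · exact (h.store_answer hT).mono le_rfl fun s' h' =>
        ⟨1, h', iff_of_true one_ne_zero (.inr ((h.eval_test hf).1 haccept))⟩
    · exact (or_iff_left (mt (h.eval_test hf).2 (not_not.2 hreject))).symm
  refine htest.seq fun s' ⟨r', h', hr'⟩ => ?_
  have hsucc : (Code.counter + 1).eval s' = t + 1 := by simp [h'.eval_counter]
  refine (h'.store_counter hT (y := Code.counter + 1) ?_ ?_).mono le_rfl fun s'' h'' =>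
    ⟨r', hsucc ▸ h'', hr'⟩
  · exact ⟨(h'.boundedReads_counter hf).mono (Nat.le_add_right _ _), trivial⟩
  · exact hsucc ▸ (Nat.size_le_size ht).trans hf.N_size

theorem Work.scan (h : Work π inp β i t r v s) (hf : Fits π inp β) (hm : 0 < π.m) (hN : 1 ≤ π.N)
    {τ : ℕ} (hv : ∀ F : Finset ℕ, ∑ x ∈ F, (v 5 x).size ≤ τ) :
    Runs scan s (β * (π.N + 1) + 3 * τ) fun s' => ∃ r', Work π inp β i π.N r' v s' ∧
      (r' ≠ 0 ↔ r ≠ 0 ∨ ∃ j, 1 ≤ j ∧ j < π.N ∧ Accepts π v j) := by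
  have htime : ∑ j ∈ Finset.Ico 1 (π.N + 1), (β + outSize π v j) ≤ β * (π.N + 1) + 3 * τ := by
    rw [Finset.sum_add_distrib, Finset.sum_const, Nat.card_Ico, Nat.add_sub_cancel, smul_eq_mul]
    linarith [sum_outSize_le hm hv (Finset.Ico 1 (π.N + 1))]
  have hstart := h.store_counter hf.pos (y := 1) trivial (by simpa using hf.pos)
  refine (hstart.mono (by nlinarith) fun _ => id).seq fun s h =>
    (Runs.loop (fun t s => ∃ r', Work π inp β i t r' v s ∧
      (r' ≠ 0 ↔ r ≠ 0 ∨ ∃ j, 1 ≤ j ∧ j < t ∧ Accepts π v j)) (fun j => β + outSize π v j)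
      (fun j => hf.pos.trans (Nat.le_add_right _ _)) hN ?_ ?_ ?_ ?_).mono htime fun _ => id
  · rintro j s ⟨r', h, -⟩
    refine ⟨⟨?_, trivial⟩, (h.boundedReads_counter hf).mono (Nat.le_add_right _ _)⟩
    exact (h.size_le hf (.inr rfl) _).trans (Nat.le_add_right _ _)
  · rintro j s hj hjN ⟨r', h, hr'⟩
    refine ⟨?_, (h.scan_step hf hjN).mono le_rfl fun s' ⟨r'', h', hr''⟩ => ⟨r'', h', ?_⟩⟩
    · simp [Code.N, h.eval_counter, h.register, Params.registers]
      omega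
    · simp only [hr'', hr', Nat.lt_succ_iff_lt_or_eq, or_and_right, and_or_left, exists_or,
        or_assoc]
      simp [hj]
  · rintro s ⟨r', h, -⟩
    simp [Code.N, h.eval_counter, h.register, Params.registers]
  · exact ⟨r, h, (or_iff_left fun ⟨j, hj, hj1, _⟩ => hj.not_gt hj1).symm⟩

end Scan

/-! ## Processing all transformers -/

/-- Process the current transformer, with an algorithm that computes transformers. -/
def process (P : Prog) : Prog :=
  .seq prepare <| .seq (P.relocate (bank 9)) <| .seq scan (.store 6 1 (Code.index + 1))

/-- Process the transformers from the current one on. -/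
def processAll (P : Prog) : Prog := .loop (Code.M - Code.index) (process P)

/-- On every transformer, the program `P` halts after time `τ`, and accepts exactly the tokens that
belong to orthogonal triples. -/
def Succeeds (π : Params) (inp : State) (P : Prog) (τ : ℕ) : Prop :=
  ∀ i, RunsWithin P (transformerInput (π.weights inp i) (π.tokens inp i)) τ fun v =>
    ∀ j, 1 ≤ j → j < π.N → (Accepts π v j ↔ π.Hit inp i j)

/-- Some token of transformer `i` belongs to an orthogonal triple. -/
def Params.Found (π : Params) (inp : State) (i : ℕ) : Prop :=
  ∃ j, 1 ≤ j ∧ j < π.N ∧ π.Hit inp i j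

section TransformerLoop

variable {π : Params} {inp : State} {β i t r τ : ℕ} {s v : State} {P : Prog}

theorem Work.next (h : Work π inp β i t r v s) (hf : Fits π inp β) :
    Runs (.store 6 1 (Code.index + 1)) s β (Ready π inp β (i + 1) r) := by
  refine Runs.store hf.pos trivial ⟨⟨h.size_le hf (.inr rfl) _, trivial⟩, trivial⟩ ?_
  have hindex : (Code.index + 1).eval s = i + 1 := by
    simp [Code.index, h.register, Params.registers]
  refine ⟨⟨t, h.counter_size, ?_⟩, h.part_lt, h.answer_le, fun a ha => ?_, fun a x hx => ?_⟩
  · rw [← π.update_registers_index i, ← h.register, hindex]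
    ext x
    simp [State.write, Function.update_apply]
  · rw [← h.input a ha]
    ext x
    exact if_neg fun hax => by omega
  · rw [← h.fresh a x hx]
    exact if_neg fun hax => bank_ne (by norm_num) a hax.1

theorem Work.relocate (h : Work π inp β i t r v s) (hf : Fits π inp β) {post : State → Prop}
    (hP : RunsWithin P v τ post) :
    Runs (P.relocate (bank 9)) s (13 * β * τ) fun s' => ∃ v', post v' ∧
      (∀ a F, ∑ x ∈ F, (v' a x).size ≤ ∑ x ∈ F, (v a x).size + τ) ∧
        Work π inp β i t r v' s' := by
  have hM : (π.registers i t r 0).size ≤ β := hf.M_size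
  have hβ := hf.pos
  exact (hP.relocate (bank_injective 9) (bank_ne (by norm_num)) h.simulates).mono
    (Nat.mul_le_mul_right _ (by omega)) fun s' ⟨v', hpost, hsize, h'⟩ =>
      ⟨v', hpost, hsize, h.of_simulates h' h.counter_size h.answer_le⟩

theorem Work.process (h : Work π inp β i t r (fun _ _ => 0) s) (hf : Fits π inp β) (hm : 0 < π.m)
    (hN : 1 ≤ π.N) (hP : Succeeds π inp P τ) :
    Runs (process P) s (13 * β * (π.tokenCount + π.weightCount + τ + 1)) fun s' =>
      ∃ r', Ready π inp β (i + 1) r' s' ∧ (r' ≠ 0 ↔ r ≠ 0 ∨ π.Found inp i) := by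
  have hβ : β ≤ 13 * β := Nat.le_mul_of_pos_left _ (by norm_num)
  have hscan : β * (π.N + 1) + 3 * τ ≤ 13 * β * (π.tokenCount + π.weightCount + τ + 1) := by
    have hNm : π.N ≤ π.tokenCount := Nat.le_mul_of_pos_right _ hm
    calc β * (π.N + 1) + 3 * τ ≤ β * (π.N + 1) + β * (3 * τ) :=
          Nat.add_le_add_left (Nat.le_mul_of_pos_left _ hf.pos) _
      _ = β * (π.N + 1 + 3 * τ) := (mul_add ..).symm
      _ ≤ β * (13 * (π.tokenCount + π.weightCount + τ + 1)) := Nat.mul_le_mul_left _ (by omega)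
      _ = 13 * β * (π.tokenCount + π.weightCount + τ + 1) := by ring
  refine ((h.prepare hf).mono (Nat.mul_le_mul hβ (by omega)) fun _ => id).seq fun s₁ h₁ =>
    ((h₁.relocate hf (hP i)).mono (Nat.mul_le_mul_left _ (by omega)) fun _ => id).seq
    fun s₂ ⟨v, haccepts, hsize, h₂⟩ => ?_
  have hout (F : Finset ℕ) : ∑ x ∈ F, (v 5 x).size ≤ τ := by
    simpa [transformerInput] using hsize 5 F
  refine ((h₂.scan hf hm hN hout).mono hscan fun _ => id).seq fun s₃ ⟨r', h₃, hr'⟩ =>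
    (h₃.next hf).mono (hβ.trans (Nat.le_mul_of_pos_right _ (Nat.succ_pos _))) fun s₄ h₄ =>
      ⟨r', h₄, hr'.trans (or_congr_right ?_)⟩
  exact exists_congr fun j => and_congr_right fun hj => and_congr_right fun hjN =>
    haccepts j hj hjN

theorem Ready.processAll (h : Ready π inp β 0 0 s) (hf : Fits π inp β) (hm : 0 < π.m)
    (hN : 1 ≤ π.N) (hP : Succeeds π inp P τ) :
    Runs (processAll P) s (13 * β * (π.tokenCount + π.weightCount + τ + 1) * (π.M + 1)) fun s' =>
      ∃ r, Ready π inp β π.M r s' ∧ (r ≠ 0 ↔ ∃ i < π.M, π.Found inp i) := by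
  have hT : β ≤ 13 * β * (π.tokenCount + π.weightCount + τ + 1) :=
    (Nat.le_mul_of_pos_left _ (by norm_num)).trans (Nat.le_mul_of_pos_right _ (Nat.succ_pos _))
  have hremaining {i r s} (h : Ready π inp β i r s) :
      (Code.M - Code.index).eval s = π.M - i := by
    obtain ⟨t, -, hreg⟩ := h.register
    simp [Code.M, Code.index, hreg, Params.registers]
  refine Runs.loop_const (fun i s => ∃ r, Ready π inp β i r s ∧
    (r ≠ 0 ↔ ∃ i' < i, π.Found inp i')) (hf.pos.trans hT) π.M ?_ ?_ ?_ ⟨0, h, by simp⟩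
  · rintro i s ⟨r, h, -⟩
    obtain ⟨t, -, hreg⟩ := h.register
    have hi := (Nat.size_le_size h.index_le).trans hf.M_size
    simp [Code.M, Code.index, hreg, Params.registers, hf.M_size.trans hT, hi.trans hT]
  · rintro i s hi ⟨r, h, hr⟩
    obtain ⟨t, hwork⟩ := h.work hi
    refine ⟨by rw [hremaining h]; omega, (hwork.process hf hm hN hP).mono le_rfl ?_⟩
    rintro s' ⟨r', h', hr'⟩
    refine ⟨r', h', hr'.trans ?_⟩
    simp only [hr, Nat.lt_succ_iff_lt_or_eq, or_and_right, exists_or, exists_eq_left]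
  · rintro s ⟨r, h, -⟩
    rw [hremaining h, Nat.sub_self]

end TransformerLoop

/-! ## Every triple of vectors occurs in some transformer -/

theorem mul_add_div_of_lt {a b c : ℕ} (hc : c < b) : (a * b + c) / b = a := by
  rw [mul_comm, Nat.mul_add_div (Nat.zero_lt_of_lt hc), Nat.div_eq_of_lt hc, add_zero]

section Coverage

variable {π : Params} {inp : State}

theorem Params.exists_lt_M {p q r : ℕ} (hp : p < π.n / (π.L * π.H) + 1) (hq : q < π.B)
    (hr : r < π.B) : ∃ i < π.M, i / (π.B * π.B) = p ∧ i / π.B % π.B = q ∧ i % π.B = r := by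
  have hdiv : ((p * π.B + q) * π.B + r) / π.B = p * π.B + q :=
    mul_add_div_of_lt hr
  refine ⟨(p * π.B + q) * π.B + r, ?_, ?_, ?_, ?_⟩
  · calc (p * π.B + q) * π.B + r < (p * π.B + q + 1) * π.B := by linarith
      _ ≤ ((p + 1) * π.B) * π.B := Nat.mul_le_mul_right _ (by linarith)
      _ ≤ π.M := by
        rw [mul_assoc]
        exact Nat.mul_le_mul_right _ hp
  · rw [← Nat.div_div_eq_div_mul, hdiv, mul_add_div_of_lt hq]
  · rw [hdiv, Nat.mul_add_mod', Nat.mod_eq_of_lt hq]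
  · rw [Nat.mul_add_mod', Nat.mod_eq_of_lt hr]

theorem exists_found_iff (hn : 0 < π.n) (hLH : 0 < π.L * π.H) (hN : 2 ≤ π.N) :
    (∃ i < π.M, π.Found inp i) ↔ ∃ x < π.n, ∃ y < π.n, ∃ z < π.n, ∀ c < π.d,
      inp 1 (x * π.d + c) * inp 2 (y * π.d + c) * inp 3 (z * π.d + c) = 0 := by
  constructor
  · rintro ⟨i, -, j, -, -, h, -, k, -, -, horth⟩
    exact ⟨_, Nat.mod_lt _ hn, _, Nat.mod_lt _ hn, _, Nat.mod_lt _ hn, horth⟩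
  · rintro ⟨x, hx, y, hy, z, hz, horth⟩
    have hblock : 0 < π.N - 1 := by omega
    have hlt {x : ℕ} (hx : x < π.n) (b : ℕ) : x / b < π.n / b + 1 :=
      Nat.lt_succ_of_le (Nat.div_le_div_right hx.le)
    obtain ⟨i, hi, hgroup, hrow, hcol⟩ := π.exists_lt_M (hlt hx _) (hlt hy _) (hlt hz _)
    have hyj := Nat.mod_lt y hblock
    have hzk := Nat.mod_lt z hblock
    refine ⟨i, hi, y % (π.N - 1) + 1, by omega, by omega, x % (π.L * π.H), Nat.mod_lt _ hLH,
      z % (π.N - 1) + 1, by omega, by omega, fun c hc => ?_⟩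
    simpa only [Params.headVec, Params.rowVec, Params.colVec, hgroup, hrow, hcol,
      Nat.add_sub_cancel, Nat.div_add_mod', Nat.mod_eq_of_lt hx, Nat.mod_eq_of_lt hy,
      Nat.mod_eq_of_lt hz] using horth c hc

theorem natArray_rowMajor {n d : ℕ} (F : Fin n → Fin d → ℕ) (x : Fin n) (c : Fin d) :
    natArray (rowMajor F) (x * d + c) = F x c := by
  have hlt : (x : ℕ) * d + c < n * d := by
    calc (x : ℕ) * d + c < (x + 1) * d := by linarith [c.isLt]
      _ ≤ n * d := Nat.mul_le_mul_right _ x.isLt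
  have hdiv : ((x : ℕ) * d + c) / d = x := mul_add_div_of_lt c.isLt
  have hmod : ((x : ℕ) * d + c) % d = c := by
    rw [Nat.mul_add_mod', Nat.mod_eq_of_lt c.isLt]
  simp only [natArray, dif_pos hlt, rowMajor]
  congr 1 <;> ext <;> simp [hdiv, hmod]

theorem exists_orthogonalTriple_iff {n d : ℕ} (A B C : Fin n → Fin d → Bool) :
    (∃ x < n, ∃ y < n, ∃ z < n, ∀ c < d, ovInput A B C 1 (x * d + c) *
      ovInput A B C 2 (y * d + c) * ovInput A B C 3 (z * d + c) = 0) ↔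
      ∃ i j k, OrthogonalTriple (A i) (B j) (C k) := by
  have hcell (i j k : Fin n) (c : Fin d) : ovInput A B C 1 (i * d + c) *
      ovInput A B C 2 (j * d + c) * ovInput A B C 3 (k * d + c) = 0 ↔
        A i c = false ∨ B j c = false ∨ C k c = false := by
    simp [ovInput, natArray_rowMajor, or_assoc]
  have htriple (i j k : Fin n) : (∀ c < d, ovInput A B C 1 (i * d + c) *
      ovInput A B C 2 (j * d + c) * ovInput A B C 3 (k * d + c) = 0) ↔
        OrthogonalTriple (A i) (B j) (C k) :=
    ⟨fun h c => (hcell i j k c).1 (h c c.2), fun h c hc => (hcell i j k ⟨c, hc⟩).2 (h ⟨c, hc⟩)⟩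
  constructor
  · rintro ⟨x, hx, y, hy, z, hz, h⟩
    exact ⟨_, _, _, (htriple ⟨x, hx⟩ ⟨y, hy⟩ ⟨z, hz⟩).1 h⟩
  · rintro ⟨i, j, k, h⟩
    exact ⟨i, i.2, j, j.2, k, k.2, (htriple i j k).2 h⟩

end Coverage

/-! ## Algorithms that compute transformers find orthogonal triples -/

section Succeeds

variable {π : Params} {inp v : State} {b τ : ℕ} {P : Prog}

theorem accepts_iff {j : ℕ} (h : v 5 (π.outAddr 2 j) ≠ 0) : Accepts π v j ↔
    (1 : ℝ) / 4 < ((v 5 (π.outAddr 0 j) : ℝ) - v 5 (π.outAddr 1 j)) / v 5 (π.outAddr 2 j) := by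
  have hpos : (0 : ℝ) < v 5 (π.outAddr 2 j) := Nat.cast_pos.2 (Nat.pos_of_ne_zero h)
  rw [lt_div_iff₀ hpos, Accepts, ← Nat.cast_lt (α := ℝ)]
  push_cast
  constructor <;> intro h <;> linarith

theorem accepts_iff_hit (hN : 2 ≤ π.N) (hm : 2 * π.d + 2 ≤ π.m)
    (hsmall : (π.L : ℝ) * π.H * (π.N * Real.exp (-π.N)) ≤ 1 / 10) {i j : ℕ} (hj : j < π.N)
    (hv : OutputsApprox ((π.weights inp i).transformer.eval
      ((π.tokens inp i).map (fun r : ℚ => (r : ℝ)))) (1 / (10 * (π.N : ℝ))) v) :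
    Accepts π v j ↔ π.Hit inp i j := by
  have hm' : 2 * π.d + 1 ≤ π.m := by omega
  let row : Fin π.N := ⟨j, hj⟩
  let col : Fin π.m := ⟨2 * π.d + 1, by omega⟩
  obtain ⟨hden, hclose⟩ := hv row col
  change |((v 5 (π.outAddr 0 j) : ℝ) - v 5 (π.outAddr 1 j)) / v 5 (π.outAddr 2 j) -
    OrthogonalityGadget.output π.N π.d π.m π.L π.H (π.headVec inp i) (π.rowVec inp i)
      (π.colVec inp i) row col| ≤ _ at hclose
  have herror : (1 : ℝ) / (10 * π.N) ≤ 1 / 20 := by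
    have : (2 : ℝ) ≤ π.N := mod_cast hN
    exact one_div_le_one_div_of_le (by norm_num) (by linarith)
  obtain ⟨hlower, hupper⟩ := abs_le.1 (hclose.trans herror)
  refine (accepts_iff hden).trans ⟨fun haccept => by_contra fun hno => ?_, fun hhit => ?_⟩
  · have hle := OrthogonalityGadget.output_le hm' row col rfl hno
    linarith
  · have hge := OrthogonalityGadget.half_le_output hm' row col rfl hhit
    linarith

theorem succeeds_of_computes (hbit : ∀ a, 1 ≤ a → a < 4 → ∀ x, inp a x ≤ 1) (hN : 2 ≤ π.N)
    (hb : 1 ≤ b) (hm : 2 * π.d + 2 ≤ π.m)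
    (hsmall : (π.L : ℝ) * π.H * (π.N * Real.exp (-π.N)) ≤ 1 / 10)
    (hP : ∀ (W : Weights π.m π.L π.H) (X : Matrix (Fin π.N) (Fin π.m) ℚ),
      W.Bounded (π.N ^ b) → (∀ i j, RatBounded (π.N ^ b) (X i j)) →
        RunsWithin P (transformerInput W X) τ (OutputsApprox
          (W.transformer.eval (X.map (fun r : ℚ => (r : ℝ)))) (1 / (10 * (π.N : ℝ))))) :
    Succeeds π inp P τ := fun i => by
  have hpow : π.N ≤ π.N ^ b := Nat.le_self_pow (by omega) _
  refine (hP _ _ (OrthogonalityGadget.weights_bounded hpow (by omega) fun h c => ?_)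
    (OrthogonalityGadget.tokens_bounded (by omega) fun j c => ?_)).mono le_rfl
      fun v hv j _ hjN => accepts_iff_hit hN hm hsmall hjN hv
  · exact hbit 1 le_rfl (by norm_num) _
  · exact hbit 2 (by norm_num) (by norm_num) _

end Succeeds

/-! ## The parameters -/

/-- The input of an algorithm that computes the parameters from `N`. -/
def paramInput (N : ℕ) : State := fun a => if a = 0 then natArray ![N] else fun _ => 0

/-- Increase register `2` while its value is less than the `e`-th root of `n`. -/
def root (e : ℕ) : Prog :=
  .loop (Code.n + 1 - (Code.N + 1).pow e) (.store 6 2 (Code.N + 1))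

/-- An output of the algorithm that computes the parameters. -/
def Code.param (x : Expr) : Expr := .load (bank 8 5) x.addr

/-- Compute the parameters, with an algorithm that computes them from `N`, where `N` is the `e`-th
root of `n`. Until the last step, register `0` is `1`: each simulated array is a whole array. -/
def setup (e : ℕ) (P : Prog) : Prog :=
  .seq (.store 6 0 1) <| .seq (root e) <| .seq (.store (bank 8 0) (0 : Expr).addr Code.N) <|
  .seq (P.relocate (bank 8)) <|
  .seq (.store 6 3 (Code.param 0)) <| .seq (.store 6 4 (Code.param 1)) <|
  .seq (.store 6 5 (Code.param 2)) <| .seq (.store 6 6 (Code.n / (Code.N - 1) + 1)) <|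
    .store 6 0 ((Code.n / (Code.L * Code.H) + 1) * (Code.B * Code.B))

/-- The state while the parameters are computed, where `ρ` are the registers and `v` is the memory
of the algorithm that computes them. -/
structure Setup (inp : State) (β : ℕ) (ρ : ℕ → ℕ) (v s : State) : Prop
    extends Simulates (bank 8) inp ρ v s where
  one_part : ρ 0 = 1
  register_size_le : ∀ x, (ρ x).size ≤ β

section Setup

variable {π : Params} {inp s v : State} {β e τ : ℕ} {ρ : ℕ → ℕ} {P : Prog}

theorem Setup.size_le (h : Setup inp β ρ v s) (hf : Fits π inp β) {a : ℕ} (ha : a = 0 ∨ a = 6)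
    (x : ℕ) : (s a x).size ≤ β := by
  rcases ha with rfl | rfl
  · rw [h.frame 0 x (by norm_num) (.inl fun b => (bank_ne (by norm_num) b).symm)]
    exact hf.input_size 0 (by norm_num) x
  · rw [h.register]
    exact h.register_size_le x

theorem Setup.input_zero (h : Setup inp β ρ v s) : s 0 = inp 0 :=
  funext fun x => h.frame 0 x (by norm_num) (.inl fun b => (bank_ne (by norm_num) b).symm)

theorem Setup.store_register (h : Setup inp β ρ v s) (hf : Fits π inp β) {x : ℕ} (hx : 2 ≤ x)
    {y : Expr} (hy : y.BoundedReads s β) (hsize : (y.eval s).size ≤ β) :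
    Runs (.store 6 (.lit x) y) s β (Setup inp β (Function.update ρ x (y.eval s)) v) :=
  (h.toSimulates.store_register (x := .lit x) (bank_ne (by norm_num)) hf.pos trivial hx hy).mono
    le_rfl fun s' h' => ⟨h', by simp [h.one_part, (show 0 ≠ x by omega)], fun z => by
      rw [Function.update_apply]
      split_ifs
      exacts [hsize, h.register_size_le z]⟩

theorem Setup.store_param (h : Setup inp β ρ v s) (hf : Fits π inp β) {x y : ℕ} (hx : 2 ≤ x)
    (hsize : (v 5 y).size ≤ β) :
    Runs (.store 6 (.lit x) (Code.param (.lit y))) s β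
      (Setup inp β (Function.update ρ x (v 5 y)) v) := by
  have heval : (Code.param (.lit y)).eval s = v 5 y := by
    rw [← h.cell, ← h.register]
    rfl
  rw [← heval] at hsize ⊢
  refine h.store_register hf hx ⟨hsize, ?_⟩ hsize
  simp [Expr.addr, Expr.BoundedReads, h.size_le hf]

theorem Setup.start (hinp : ∀ a, 4 ≤ a → inp a = fun _ => 0) (hβ : 1 ≤ β) :
    Setup inp β (Function.update (fun _ => 0) 0 1) (fun _ _ => 0) (inp.write 6 0 1) where
  part_lt := by simp
  register := by
    ext x
    simp [State.write, Function.update_apply, hinp 6 (by norm_num)]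
  cell a x := by
    simp [State.write, bank_ne (show 6 < 8 by norm_num) a,
      hinp (bank 8 a) (by simp only [bank]; omega)]
  frame a x ha _ := if_neg fun h => ha h.1
  one_part := by simp
  register_size_le x := by
    rw [Function.update_apply]
    split_ifs <;> simp [hβ]

theorem Setup.root (h : Setup inp β ρ v s) (hf : Fits π inp β) (hρ : ρ 2 = 0)
    (hle : π.N ^ e ≤ π.n) (hlt : π.n < (π.N + 1) ^ e) :
    Runs (root e) s (β * (π.N + 1)) (Setup inp β (Function.update ρ 2 π.N) v) := by
  have hN {t : ℕ} {s : State} (h : Setup inp β (Function.update ρ 2 t) v s) :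
      Code.N.eval s = t := by simp [Code.N, h.register]
  have hcond {t : ℕ} {s : State} (h : Setup inp β (Function.update ρ 2 t) v s) :
      (Code.n + 1 - (Code.N + 1).pow e).eval s = π.n + 1 - (t + 1) ^ e := by
    simp [hN h, Code.n, h.input_zero, hf.n_eq]
  have hreads {t : ℕ} {s : State} (h : Setup inp β (Function.update ρ 2 t) v s) :
      Code.N.BoundedReads s β := ⟨h.size_le hf (.inr rfl) _, trivial⟩
  refine Runs.loop_const (fun t => Setup inp β (Function.update ρ 2 t) v) hf.pos π.N
    (fun t s h => ?_) (fun t s ht h => ?_) (fun s h => ?_) ?_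
  · simp [Code.n, h.size_le hf, Expr.BoundedReads.pow, hreads h]
  · have hpow : (t + 1) ^ e ≤ π.N ^ e := Nat.pow_le_pow_left ht e
    have hsucc : (Code.N + 1).eval s = t + 1 := by simp [hN h]
    refine ⟨by rw [hcond h]; omega, ?_⟩
    have hstep := h.store_register hf le_rfl (y := Code.N + 1) (by simp [hreads h])
      (hsucc ▸ (Nat.size_le_size ht).trans hf.N_size)
    rwa [hsucc, Function.update_idem] at hstep
  · rw [hcond h]
    omega
  · rwa [← hρ, Function.update_eq_self]

theorem Setup.ready (h : Setup inp β ρ v s) (hf : Fits π inp β)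
    (hinp : ∀ a, 4 ≤ a → inp a = fun _ => 0)
    (hρ : Function.update ρ 0 π.M = π.registers 0 0 0) :
    Runs (.store 6 0 ((Code.n / (Code.L * Code.H) + 1) * (Code.B * Code.B))) s β
      (Ready π inp β 0 0) := by
  have hreg {x : ℕ} (hx : x ≠ 0) : s 6 x = π.registers 0 0 0 x := by
    rw [h.register, ← hρ, Function.update_of_ne hx]
  have hM : ((Code.n / (Code.L * Code.H) + 1) * (Code.B * Code.B)).eval s = π.M := by
    simp [Code.n, Code.L, Code.H, Code.B, hreg, h.input_zero, hf.n_eq, Params.registers, Params.M]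
  have hother {a : ℕ} (ha : a ≠ 6) (hbank : ∀ b, a ≠ bank 8 b) (x : ℕ) (y : ℕ) :
      s.write 6 0 y a x = inp a x := by
    rw [← h.frame a x ha (.inl hbank)]
    simp [State.write, ha]
  refine Runs.store hf.pos trivial
    (by simp [Code.n, Code.L, Code.H, Code.B, h.size_le hf]) ⟨⟨0, by simp, ?_⟩, Nat.zero_le _,
      Nat.zero_le _, fun a ha => funext fun x => ?_, fun a x _ => ?_⟩
  · rw [hM, ← hρ, ← h.register]
    ext x
    simp [State.write, Function.update_apply]
  · exact hother (by omega) (fun b => (bank_ne (by omega) b).symm) x _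
  · exact (hother (bank_ne (by norm_num) a) (fun b => by simp only [bank]; omega) x _).trans
      (congrFun (hinp _ (by simp only [bank]; omega)) x)

theorem Setup.store_N (h : Setup inp β ρ (fun _ _ => 0) s) (hf : Fits π inp β) (hρ : ρ 2 = π.N) :
    Runs (.store (bank 8 0) (0 : Expr).addr Code.N) s β (Setup inp β ρ (paramInput π.N)) := by
  have hwrite : State.write (fun _ _ => 0) 0 0 π.N = paramInput π.N := by
    ext a x
    by_cases ha : a = 0 <;> by_cases hx : x = 0 <;>
      simp [paramInput, State.write, natArray, ha, hx]
  have hN : Code.N.eval s = π.N := by simp [Code.N, h.register, hρ]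
  refine (h.toSimulates.store (bank_injective 8) (bank_ne (by norm_num)) hf.pos
    (h.register_size_le 0) 0 (x := 0) (y := Code.N) trivial
      ⟨h.size_le hf (.inr rfl) _, trivial⟩).mono le_rfl
      fun s' h' => ⟨?_, h.one_part, h.register_size_le⟩
  rwa [hN, Expr.eval_ofNat, hwrite] at h'

theorem Setup.relocate (h : Setup inp β ρ v s) {post : State → Prop}
    (hP : RunsWithin P v τ post) :
    Runs (P.relocate (bank 8)) s (13 * τ) fun s' => ∃ v', post v' ∧ Setup inp β ρ v' s' := by
  refine (hP.relocate (bank_injective 8) (bank_ne (by norm_num)) h.toSimulates).mono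
    (by simp [h.one_part]) fun s' ⟨v', hpost, _, h'⟩ =>
      ⟨v', hpost, h', h.one_part, h.register_size_le⟩

theorem Fits.setup (hf : Fits π inp β) (hinp : ∀ a, 4 ≤ a → inp a = fun _ => 0)
    (hle : π.N ^ e ≤ π.n) (hlt : π.n < (π.N + 1) ^ e)
    (hP : RunsWithin P (paramInput π.N) τ fun v =>
      v outArray 0 = π.m ∧ v outArray 1 = π.L ∧ v outArray 2 = π.H) :
    Runs (setup e P) inp (13 * β * (π.N + τ + 1)) (Ready π inp β 0 0) := by
  have hβ : β ≤ 13 * β * (π.N + τ + 1) :=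
    (Nat.le_mul_of_pos_left _ (by norm_num)).trans (Nat.le_mul_of_pos_right _ (Nat.succ_pos _))
  have hroot : β * (π.N + 1) ≤ 13 * β * (π.N + τ + 1) := Nat.mul_le_mul (by omega) (by omega)
  have hsim : 13 * τ ≤ 13 * β * (π.N + τ + 1) :=
    Nat.mul_le_mul (Nat.le_mul_of_pos_right _ hf.pos) (by omega)
  refine (Runs.store (i := 0) (e := 1) (hf.pos.trans hβ) trivial trivial
    (Setup.start hinp hf.pos)).seq fun s₁ h₁ =>
    ((h₁.root hf (by simp) hle hlt).mono hroot fun _ => id).seq fun s₂ h₂ =>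
    ((h₂.store_N hf (by simp)).mono hβ fun _ => id).seq fun s₃ h₃ =>
    ((h₃.relocate hP).mono hsim fun _ => id).seq fun s₄ ⟨v, ⟨hm, hL, hH⟩, h₄⟩ =>
    ((h₄.store_param hf (by norm_num) (hm ▸ hf.m_size)).mono hβ fun _ => id).seq fun s₅ h₅ =>
    ((h₅.store_param hf (by norm_num) (hL ▸ hf.L_size)).mono hβ fun _ => id).seq fun s₆ h₆ =>
    ((h₆.store_param hf (by norm_num) (hH ▸ hf.H_size)).mono hβ fun _ => id).seq fun s₇ h₇ => ?_
  have hB : (Code.n / (Code.N - 1) + 1).eval s₇ = π.B := by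
    simp [Code.n, Code.N, h₇.register, h₇.input_zero, hf.n_eq, Params.B]
  refine ((h₇.store_register hf (x := 6) (by norm_num)
    (by simp [Code.n, Code.N, h₇.size_le hf]) (hB ▸ hf.B_size)).mono hβ fun _ => id).seq
    fun s₈ h₈ => (h₈.ready hf hinp ?_).mono hβ fun _ => id
  rw [hB, show v 5 0 = π.m from hm, show v 5 1 = π.L from hL, show v 5 2 = π.H from hH]
  ext x
  rcases x with _ | _ | _ | _ | _ | _ | _ | _ | _ | x <;> simp [Params.registers]

end Setup

/-! ## The reduction -/

/-- The algorithm for 3-OV that uses the algorithm `P` for transformers, and the algorithm `Pparam`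
for their parameters. -/
def reduction (e : ℕ) (Pparam P : Prog) : Prog :=
  .seq (setup e Pparam) <| .seq (processAll P) (.store 5 0 Code.answer)

section Reduction

variable {π : Params} {A B C : Fin π.n → Fin π.d → Bool} {β τ₁ τ₂ e : ℕ} {Pparam P : Prog}

theorem ovInput_le_one {n d : ℕ} (A B C : Fin n → Fin d → Bool) {a : ℕ} (ha : 1 ≤ a) (ha' : a < 4)
    (x : ℕ) : ovInput A B C a x ≤ 1 := by
  interval_cases a
  all_goals
    simp only [ovInput, natArray, rowMajor]
    split_ifs
    · exact Bool.toNat_le _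
    · exact Nat.zero_le _

theorem Fits.reduction (hf : Fits π (ovInput A B C) β) (hn : 0 < π.n) (hN : 2 ≤ π.N)
    (hLH : 0 < π.L * π.H) (hm : 2 * π.d + 2 ≤ π.m) (hle : π.N ^ e ≤ π.n)
    (hlt : π.n < (π.N + 1) ^ e)
    (hparam : RunsWithin Pparam (paramInput π.N) τ₁ fun v =>
      v outArray 0 = π.m ∧ v outArray 1 = π.L ∧ v outArray 2 = π.H)
    (hP : Succeeds π (ovInput A B C) P τ₂) :
    Runs (reduction e Pparam P) (ovInput A B C) (13 * β * (π.N + τ₁ + 1) +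
      13 * β * (π.tokenCount + π.weightCount + τ₂ + 1) * (π.M + 1))
      fun s => s outArray 0 ≠ 0 ↔ ∃ i j k, OrthogonalTriple (A i) (B j) (C k) := by
  have hβ : β ≤ 13 * β * (π.N + τ₁ + 1) :=
    (Nat.le_mul_of_pos_left _ (by norm_num)).trans (Nat.le_mul_of_pos_right _ (Nat.succ_pos _))
  have hinp : ∀ a, 4 ≤ a → ovInput A B C a = fun _ => 0 := by
    rintro (_ | _ | _ | _ | a) ha <;> first | rfl | omega
  refine ((hf.setup hinp hle hlt hparam).mono (Nat.le_add_right _ _) fun _ => id).seq fun s h =>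
    ((h.processAll hf (by omega) (by omega) hP).mono (Nat.le_add_left _ _) fun _ => id).seq
      fun s ⟨r, h, hr⟩ => ?_
  obtain ⟨t, _, hreg⟩ := h.register
  have hanswer : Code.answer.eval s = r := by simp [Code.answer, hreg, Params.registers]
  have hsize : r.size ≤ β := (Nat.size_le_size h.answer_le).trans (by simpa using hf.pos)
  refine (Runs.store (T := β) (i := 0) (e := Code.answer) hf.pos trivial
    ⟨by rwa [hreg], trivial⟩ ?_).mono (hβ.trans (Nat.le_add_right _ _)) fun _ => id
  rw [hanswer, ← exists_orthogonalTriple_iff, ← exists_found_iff hn hLH hN, ← hr]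
  simp [State.write, outArray]

end Reduction

/-! ## The running time -/

/-- The relations between the parameters under which the reduction is correct and fast, where `N` is
the `e`-th root of `n`. -/
structure Admissible (e : ℕ) (π : Params) : Prop where
  two_le_N : 2 ≤ π.N
  L_pos : 1 ≤ π.L
  H_pos : 1 ≤ π.H
  dim_le : 2 * π.d + 2 ≤ π.m
  m_le : π.m ≤ π.N
  pow_le : π.N ^ e ≤ π.n
  lt_pow : π.n < (π.N + 1) ^ e
  mul_le : π.L * π.H ≤ π.n
  error_le : (π.L : ℝ) * π.H * (π.N * Real.exp (-π.N)) ≤ 1 / 10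

section Admissible

variable {π : Params} {e k τ₁ τ₂ : ℕ} {K₁ K₂ ε δ : ℝ}

theorem ovInput_size_le {n d : ℕ} (A B C : Fin n → Fin d → Bool) (hn : 0 < n) (hd : d ≤ n) {a : ℕ}
    (ha : a < 4) (x : ℕ) : (ovInput A B C a x).size ≤ n.size := by
  refine Nat.size_le_size ?_
  rcases Nat.eq_zero_or_pos a with rfl | hpos
  · simp only [ovInput, natArray]
    split_ifs with hx
    · interval_cases x
      exacts [le_rfl, hd]
    · exact Nat.zero_le n
  · exact (ovInput_le_one A B C hpos ha x).trans hn

theorem size_div_add_one_le (n x : ℕ) : (n / x + 1).size ≤ n.size + 1 := by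
  refine Nat.size_le.2 ?_
  have := Nat.lt_size_self n
  have := Nat.div_le_self n x
  have := Nat.one_le_two_pow (n := n.size)
  rw [pow_succ]
  omega

namespace Admissible

theorem n_pos (h : Admissible e π) : 0 < π.n :=
  (Nat.pow_pos (Nat.zero_lt_of_lt h.two_le_N)).trans_le h.pow_le

theorem e_ne_zero (h : Admissible e π) : e ≠ 0 := by
  rintro rfl
  have := h.n_pos
  have := h.lt_pow
  simp_all

theorem N_le_n (h : Admissible e π) : π.N ≤ π.n :=
  (Nat.le_self_pow h.e_ne_zero _).trans h.pow_le

theorem fits (h : Admissible e π) (A B C : Fin π.n → Fin π.d → Bool) :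
    Fits π (ovInput A B C) (8 * π.n.size) := by
  have hn : 0 < π.n.size := Nat.size_pos.2 h.n_pos
  have hN : π.N.size ≤ π.n.size := Nat.size_le_size h.N_le_n
  have hm : π.m.size ≤ π.n.size := Nat.size_le_size (h.m_le.trans h.N_le_n)
  have hL : π.L.size ≤ π.n.size :=
    Nat.size_le_size ((Nat.le_mul_of_pos_right _ h.H_pos).trans h.mul_le)
  have hH : π.H.size ≤ π.n.size :=
    Nat.size_le_size ((Nat.le_mul_of_pos_left _ h.L_pos).trans h.mul_le)
  have hB : π.B.size ≤ π.n.size + 1 := size_div_add_one_le _ _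
  have hM : π.M.size ≤ 3 * (π.n.size + 1) := by
    have hgroups := size_div_add_one_le π.n (π.L * π.H)
    have hblocks := size_mul_le π.B π.B
    exact (size_mul_le _ _).trans (by omega)
  have htokens : π.tokenCount.size ≤ π.N.size + π.m.size := size_mul_le _ _
  have hweights : π.weightCount.size ≤ π.L.size + (π.H.size + (π.m.size + π.m.size)) :=
    (size_mul_le _ _).trans <| Nat.add_le_add_left ((size_mul_le _ _).trans <|
      Nat.add_le_add_left (size_mul_le _ _) _) _
  have hd : π.d ≤ π.n := by linarith [h.dim_le, h.m_le, h.N_le_n]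
  exact ⟨by omega, rfl, rfl, fun a ha x => (ovInput_size_le A B C h.n_pos hd ha x).trans (by omega),
    by omega, by omega, by omega, by omega, by omega, by omega, by omega, by omega⟩

theorem M_mul_le (h : Admissible e π) :
    (π.M + 1) * (π.L * π.H * π.N ^ 2) ≤ 64 * π.n ^ 3 := by
  have hN := h.two_le_N
  have hN_le := h.N_le_n
  have hLH := h.mul_le
  have hgroups : (π.n / (π.L * π.H) + 1) * (π.L * π.H) ≤ 2 * π.n := by
    have := Nat.div_mul_le_self π.n (π.L * π.H)
    rw [add_mul]
    omega
  have hblocks : π.B * π.N ≤ 4 * π.n :=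
    calc π.B * π.N ≤ π.B * (2 * (π.N - 1)) := Nat.mul_le_mul_left _ (by omega)
      _ = 2 * (π.n / (π.N - 1) * (π.N - 1) + (π.N - 1)) := by rw [Params.B]; ring
      _ ≤ 2 * (π.n + π.n) := by
        gcongr
        · exact Nat.div_mul_le_self _ _
        · omega
      _ = 4 * π.n := by ring
  have hM : 1 ≤ π.M :=
    Nat.mul_pos (Nat.succ_pos _) (Nat.mul_pos (Nat.succ_pos _) (Nat.succ_pos _))
  calc (π.M + 1) * (π.L * π.H * π.N ^ 2) ≤ (2 * π.M) * (π.L * π.H * π.N ^ 2) := by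
        gcongr
        omega
    _ = 2 * (((π.n / (π.L * π.H) + 1) * (π.L * π.H)) * ((π.B * π.N) * (π.B * π.N))) := by
      rw [Params.M]
      ring
    _ ≤ 2 * ((2 * π.n) * ((4 * π.n) * (4 * π.n))) := by gcongr
    _ = 64 * π.n ^ 3 := by ring

theorem setup_time_le (h : Admissible e π) (hke : k ≤ e) (hδ : δ ≤ 1) (hK₁ : 0 ≤ K₁)
    (hτ₁ : (τ₁ : ℝ) ≤ K₁ * (π.N : ℝ) ^ k) :
    (π.N : ℝ) + τ₁ + 1 ≤
      (2 + K₁) * ((π.m : ℝ) ^ 2 * ((π.n : ℝ) ^ 3 * (π.N : ℝ) ^ (-δ))) := by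
  have hN : (1 : ℝ) ≤ π.N := mod_cast one_le_two.trans h.two_le_N
  have hNn : (π.N : ℝ) ≤ π.n := mod_cast h.N_le_n
  have hm : (1 : ℝ) ≤ π.m := mod_cast (Nat.le_add_left 1 _).trans h.dim_le
  have hpow : (π.N : ℝ) ^ k ≤ π.n :=
    (pow_le_pow_right₀ hN hke).trans (mod_cast h.pow_le)
  have hloss : (1 : ℝ) ≤ π.n * (π.N : ℝ) ^ (-δ) :=
    calc (1 : ℝ) ≤ (π.N : ℝ) ^ (1 - δ) := Real.one_le_rpow hN (by linarith)
      _ = π.N * (π.N : ℝ) ^ (-δ) := by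
        rw [sub_eq_add_neg, Real.rpow_add (by linarith), Real.rpow_one]
      _ ≤ π.n * (π.N : ℝ) ^ (-δ) := by gcongr
  have hn : (π.n : ℝ) ≤ (π.n : ℝ) ^ 2 := le_self_pow₀ (hN.trans hNn) two_ne_zero
  calc (π.N : ℝ) + τ₁ + 1 ≤ π.n + K₁ * π.n + π.n := by
        gcongr
        · exact hτ₁.trans (by gcongr)
        · linarith
    _ = (2 + K₁) * (1 * (π.n * 1)) := by ring
    _ ≤ (2 + K₁) * ((π.m : ℝ) ^ 2 * ((π.n : ℝ) ^ 2 * (π.n * (π.N : ℝ) ^ (-δ)))) := by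
      gcongr
      exact one_le_pow₀ hm
    _ = _ := by ring

theorem transformer_time_le (h : Admissible e π) (hδ : δ ≤ 1) (hδε : δ ≤ ε) (hK₂ : 0 ≤ K₂)
    (hτ₂ : (τ₂ : ℝ) ≤ K₂ * ((π.L : ℝ) * π.H * (π.N : ℝ) ^ (2 - ε))) :
    (π.tokenCount : ℝ) + π.weightCount + τ₂ + 1 ≤
      (3 + K₂) * ((π.m : ℝ) ^ 2 * (π.L * π.H * (π.N : ℝ) ^ (2 - δ))) := by
  have hN : (1 : ℝ) ≤ π.N := mod_cast one_le_two.trans h.two_le_N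
  have hm : (1 : ℝ) ≤ π.m := mod_cast (Nat.le_add_left 1 _).trans h.dim_le
  have hLH : (1 : ℝ) ≤ π.L * π.H := mod_cast Nat.mul_pos h.L_pos h.H_pos
  have hNδ : (π.N : ℝ) ≤ (π.N : ℝ) ^ (2 - δ) := by
    simpa using Real.rpow_le_rpow_of_exponent_le hN (show (1 : ℝ) ≤ 2 - δ by linarith)
  have hεδ : (π.N : ℝ) ^ (2 - ε) ≤ (π.N : ℝ) ^ (2 - δ) :=
    Real.rpow_le_rpow_of_exponent_le hN (by linarith)
  set q := (π.L : ℝ) * π.H with hq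
  set p := (π.N : ℝ) ^ (2 - δ)
  have hp : 1 ≤ p := hN.trans hNδ
  have hm2 : (π.m : ℝ) ≤ (π.m : ℝ) ^ 2 := le_self_pow₀ hm two_ne_zero
  have htokens : (π.tokenCount : ℝ) ≤ (π.m : ℝ) ^ 2 * (q * p) :=
    calc (π.tokenCount : ℝ) = π.m * (1 * π.N) := by
          rw [Params.tokenCount]
          push_cast
          ring
      _ ≤ (π.m : ℝ) ^ 2 * (q * p) := by gcongr
  have hweights : (π.weightCount : ℝ) ≤ (π.m : ℝ) ^ 2 * (q * p) :=
    calc (π.weightCount : ℝ) = (π.m : ℝ) ^ 2 * (q * 1) := by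
          rw [hq, Params.weightCount]
          push_cast
          ring
      _ ≤ (π.m : ℝ) ^ 2 * (q * p) := by gcongr
  have hsim : (τ₂ : ℝ) ≤ K₂ * ((π.m : ℝ) ^ 2 * (q * p)) :=
    hτ₂.trans <| mul_le_mul_of_nonneg_left
      (calc q * (π.N : ℝ) ^ (2 - ε) ≤ 1 * (q * p) := by rw [one_mul]; gcongr
        _ ≤ (π.m : ℝ) ^ 2 * (q * p) := by gcongr; exact one_le_pow₀ hm) hK₂
  have hone : 1 ≤ (π.m : ℝ) ^ 2 * (q * p) :=
    one_le_mul_of_one_le_of_one_le (one_le_pow₀ hm) (one_le_mul_of_one_le_of_one_le hLH hp)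
  linarith

theorem time_le (h : Admissible e π) (hke : k ≤ e) (hδ : δ ≤ 1) (hδε : δ ≤ ε) (hK₁ : 0 ≤ K₁)
    (hK₂ : 0 ≤ K₂) (hτ₁ : (τ₁ : ℝ) ≤ K₁ * (π.N : ℝ) ^ k)
    (hτ₂ : (τ₂ : ℝ) ≤ K₂ * ((π.L : ℝ) * π.H * (π.N : ℝ) ^ (2 - ε))) :
    ((π.N : ℝ) + τ₁ + 1) + (π.tokenCount + π.weightCount + τ₂ + 1) * (π.M + 1) ≤
      (2 + K₁ + 64 * (3 + K₂)) * ((π.m : ℝ) ^ 2 * ((π.n : ℝ) ^ 3 * (π.N : ℝ) ^ (-δ))) := by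
  have hN : (0 : ℝ) < π.N := mod_cast Nat.zero_lt_of_lt h.two_le_N
  have hpow : (π.N : ℝ) ^ (2 - δ) = (π.N : ℝ) ^ 2 * (π.N : ℝ) ^ (-δ) := by
    rw [sub_eq_add_neg, Real.rpow_add hN, Real.rpow_two]
  have hM : ((π.M : ℝ) + 1) * (π.L * π.H * (π.N : ℝ) ^ 2) ≤ 64 * (π.n : ℝ) ^ 3 :=
    mod_cast h.M_mul_le
  rw [add_mul (2 + K₁)]
  refine add_le_add (h.setup_time_le hke hδ hK₁ hτ₁) ?_
  calc ((π.tokenCount : ℝ) + π.weightCount + τ₂ + 1) * (π.M + 1)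
      ≤ (3 + K₂) * ((π.m : ℝ) ^ 2 * (π.L * π.H * (π.N : ℝ) ^ (2 - δ))) * (π.M + 1) := by
        gcongr
        exact h.transformer_time_le hδ hδε hK₂ hτ₂
    _ = (3 + K₂) * ((π.m : ℝ) ^ 2 * ((((π.M : ℝ) + 1) * (π.L * π.H * (π.N : ℝ) ^ 2)) *
          (π.N : ℝ) ^ (-δ))) := by
      rw [hpow]
      ring
    _ ≤ (3 + K₂) * ((π.m : ℝ) ^ 2 * ((64 * (π.n : ℝ) ^ 3) * (π.N : ℝ) ^ (-δ))) := by gcongr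
    _ = _ := by ring

end Admissible

end Admissible

/-! ## Asymptotics -/

section Asymptotics

variable {m L H : ℕ → ℕ} {k e : ℕ} {δ : ℝ}

theorem clog_le_of_lt_pow {n N : ℕ} (h : n < (N + 1) ^ e) : Nat.clog 2 n ≤ e * N.size := by
  refine (Nat.clog_le_iff_le_pow one_lt_two).2 (h.le.trans ?_)
  rw [mul_comm, pow_mul]
  exact Nat.pow_le_pow_left (Nat.lt_size_self N) e

theorem size_le_two_mul_logb {n : ℕ} (hn : 2 ≤ n) : (n.size : ℝ) ≤ 2 * Real.logb 2 n := by
  have hsize : (n.size : ℝ) ≤ Nat.log 2 n + 1 :=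
    mod_cast Nat.size_le.2 (Nat.lt_pow_succ_log_self one_lt_two n)
  have hlog : (1 : ℝ) ≤ Nat.log 2 n := mod_cast Nat.log_pos one_lt_two hn
  have hlogb : (Nat.log 2 n : ℝ) ≤ Real.logb 2 n := Real.natLog_le_logb n 2
  linarith

theorem size_isBigO_log : (fun n : ℕ => (n.size : ℝ)) =O[atTop] fun n : ℕ => Real.log n := by
  refine IsBigO.of_bound (2 / Real.log 2) ?_
  filter_upwards [eventually_ge_atTop 2] with n hn
  rw [Real.norm_of_nonneg (Nat.cast_nonneg _), Real.norm_of_nonneg (Real.log_natCast_nonneg n)]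
  exact (size_le_two_mul_logb hn).trans_eq (by rw [Real.logb]; ring)

theorem log_pow_three_isBigO_rpow {s : ℝ} (hs : 0 < s) :
    (fun n : ℕ => Real.log n ^ 3) =O[atTop] fun n : ℕ => (n : ℝ) ^ s := by
  have h := (isLittleO_log_rpow_rpow_atTop 3 hs).isBigO.comp_tendsto
    (tendsto_natCast_atTop_atTop (R := ℝ))
  exact h.congr_left fun n => Real.rpow_natCast _ 3

theorem tendsto_nthRoot_atTop (he : e ≠ 0) : Tendsto (Nat.nthRoot e) atTop atTop :=
  tendsto_atTop.2 fun r => (eventually_ge_atTop (r ^ e)).mono fun _ => (Nat.le_nthRoot_iff he).2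

theorem log_nthRoot_isBigO_log (he : e ≠ 0) :
    (fun n => Real.log (Nat.nthRoot e n)) =O[atTop] fun n : ℕ => Real.log n := by
  refine IsBigO.of_bound' ?_
  filter_upwards [(tendsto_nthRoot_atTop he).eventually (eventually_gt_atTop 0)] with n hN
  rw [Real.norm_of_nonneg (Real.log_natCast_nonneg _),
    Real.norm_of_nonneg (Real.log_natCast_nonneg _)]
  have hle : Nat.nthRoot e n ≤ n :=
    (Nat.le_self_pow he _).trans (Nat.pow_nthRoot_le_iff.2 (.inl he))
  gcongr

theorem nthRoot_rpow_neg_le {n : ℕ} (he : e ≠ 0) (hn : 0 < n) (hN : 0 < Nat.nthRoot e n)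
    (hδ : 0 ≤ δ) (hδ' : δ ≤ 1) :
    (Nat.nthRoot e n : ℝ) ^ (-δ) ≤ 2 * (n : ℝ) ^ (-(δ / e)) := by
  set N := Nat.nthRoot e n
  have hN' : (0 : ℝ) < N := mod_cast hN
  have hn' : (0 : ℝ) < n := mod_cast hn
  have hle : (n : ℝ) ≤ (2 * N) ^ e := by
    exact_mod_cast (Nat.lt_pow_nthRoot_add_one he n).le.trans (Nat.pow_le_pow_left (by omega) e)
  have hrpow : (n : ℝ) ^ (δ / e) ≤ 2 * (N : ℝ) ^ δ := by
    calc (n : ℝ) ^ (δ / e) ≤ ((2 * (N : ℝ)) ^ e) ^ (δ / e) := by gcongr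
      _ = (2 * (N : ℝ)) ^ δ := by
        rw [← Real.rpow_natCast, ← Real.rpow_mul (by positivity), mul_div_cancel₀]
        exact mod_cast he
      _ = (2 : ℝ) ^ δ * (N : ℝ) ^ δ := Real.mul_rpow zero_le_two hN'.le
      _ ≤ 2 * (N : ℝ) ^ δ := by
        gcongr
        simpa using Real.rpow_le_rpow_of_exponent_le one_le_two hδ'
  rw [Real.rpow_neg hN'.le, Real.rpow_neg hn'.le, ← div_eq_mul_inv, inv_eq_one_div,
    div_le_div_iff₀ (by positivity) (by positivity)]
  linarith

theorem nthRoot_rpow_neg_isBigO (he : e ≠ 0) (hδ : 0 ≤ δ) (hδ' : δ ≤ 1) :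
    (fun n => (Nat.nthRoot e n : ℝ) ^ (-δ)) =O[atTop] fun n : ℕ => (n : ℝ) ^ (-(δ / e)) := by
  refine IsBigO.of_bound 2 ?_
  filter_upwards [eventually_gt_atTop 0,
    (tendsto_nthRoot_atTop he).eventually (eventually_gt_atTop 0)] with n hn hN
  rw [Real.norm_of_nonneg (by positivity), Real.norm_of_nonneg (by positivity)]
  exact nthRoot_rpow_neg_le he hn hN hδ hδ'

theorem time_isBigO (hm : (fun N => (m N : ℝ)) =O[atTop] fun N : ℕ => Real.log N) (he : e ≠ 0)
    (hδ : 0 < δ) (hδ' : δ ≤ 1) :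
    (fun n => (n.size : ℝ) * ((m (Nat.nthRoot e n) : ℝ) ^ 2 *
      ((n : ℝ) ^ 3 * (Nat.nthRoot e n : ℝ) ^ (-δ)))) =O[atTop]
        fun n : ℕ => (n : ℝ) ^ (3 - δ / (2 * e)) := by
  have hmlog : (fun n => (m (Nat.nthRoot e n) : ℝ)) =O[atTop] fun n : ℕ => Real.log n :=
    (hm.comp_tendsto (tendsto_nthRoot_atTop he)).trans (log_nthRoot_isBigO_log he)
  have hpoly := (isBigO_refl (fun n : ℕ => (n : ℝ) ^ 3) atTop).mul
    (nthRoot_rpow_neg_isBigO he hδ.le hδ')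
  have hlog := (log_pow_three_isBigO_rpow (s := δ / (2 * e)) (by positivity)).mul
    (isBigO_refl (fun n : ℕ => (n : ℝ) ^ 3 * (n : ℝ) ^ (-(δ / e))) atTop)
  refine (((size_isBigO_log.mul ((hmlog.pow 2).mul hpoly)).congr_right fun n => ?_).trans
    hlog).congr' .rfl ?_
  · ring
  · filter_upwards [eventually_gt_atTop 0] with n hn
    have hn' : (0 : ℝ) < n := mod_cast hn
    rw [← Real.rpow_natCast, ← Real.rpow_add hn', ← Real.rpow_add hn']
    congr 1
    field_simp
    push_cast
    ring

theorem eventually_mul_le_pow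
    (hL : (fun N => (L N : ℝ)) =O[atTop] fun N : ℕ => (N : ℝ) ^ k)
    (hH : (fun N => (H N : ℝ)) =O[atTop] fun N : ℕ => (N : ℝ) ^ k) :
    ∀ᶠ N : ℕ in atTop, L N * H N ≤ N ^ (2 * k + 1) := by
  obtain ⟨C, hC⟩ := (hL.mul hH).bound
  filter_upwards [hC, eventually_ge_atTop ⌈C⌉₊] with N hLH hN
  rw [Real.norm_of_nonneg (by positivity), Real.norm_of_nonneg (by positivity)] at hLH
  have hle : (L N : ℝ) * H N ≤ (N : ℝ) ^ (2 * k + 1) :=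
    calc (L N : ℝ) * H N ≤ C * ((N : ℝ) ^ k * (N : ℝ) ^ k) := hLH
      _ ≤ N * ((N : ℝ) ^ k * (N : ℝ) ^ k) := by
        gcongr
        exact Nat.ceil_le.1 hN
      _ = (N : ℝ) ^ (2 * k + 1) := by ring
  exact_mod_cast hle

theorem eventually_pow_mul_exp_neg_le (k : ℕ) :
    ∀ᶠ N : ℕ in atTop, (N : ℝ) ^ k * Real.exp (-N) ≤ 1 / 10 :=
  ((Real.tendsto_pow_mul_exp_neg_atTop_nhds_zero k).comp
    tendsto_natCast_atTop_atTop).eventually_le_const (by norm_num)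

theorem eventually_le_self (hm : (fun N => (m N : ℝ)) =O[atTop] fun N : ℕ => Real.log N) :
    ∀ᶠ N : ℕ in atTop, m N ≤ N := by
  have h := hm.trans_isLittleO (Real.isLittleO_log_id_atTop.comp_tendsto
    (tendsto_natCast_atTop_atTop (R := ℝ)))
  filter_upwards [h.bound one_pos] with N hN
  simpa using hN

theorem two_mul_dim_add_two_le {n N c m : ℕ} (hN : 2 ≤ N) (hlt : n < (N + 1) ^ e)
    (hm : ((4 * c * e + 2 : ℕ) : ℝ) * Real.logb 2 N ≤ m) : 2 * (c * Nat.clog 2 n) + 2 ≤ m := by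
  have hclog : (Nat.clog 2 n : ℝ) ≤ e * (2 * Real.logb 2 N) :=
    calc (Nat.clog 2 n : ℝ) ≤ e * N.size := mod_cast clog_le_of_lt_pow hlt
      _ ≤ e * (2 * Real.logb 2 N) := by
        gcongr
        exact size_le_two_mul_logb hN
  have hlog : 1 ≤ Real.logb 2 N := by
    rw [Real.le_logb_iff_rpow_le one_lt_two (by positivity), Real.rpow_one]
    exact mod_cast hN
  have hle : (2 * (c * Nat.clog 2 n) + 2 : ℝ) ≤ m :=
    calc (2 * (c * Nat.clog 2 n) + 2 : ℝ)
        ≤ 2 * (c * (e * (2 * Real.logb 2 N))) + 2 * Real.logb 2 N := by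
          gcongr
          linarith
      _ = ((4 * c * e + 2 : ℕ) : ℝ) * Real.logb 2 N := by
        push_cast
        ring
      _ ≤ m := hm
  exact_mod_cast hle

end Asymptotics

/-! ## From transformers to 3-OV -/

section Main

variable {m L H : ℕ → ℕ} {k c b : ℕ} {ε δ : ℝ}

/-- The parameters for `n` vectors of dimension `d`: the input length is the `e`-th root of `n`. -/
def paramsFor (e : ℕ) (m L H : ℕ → ℕ) (n d : ℕ) : Params :=
  ⟨n, d, Nat.nthRoot e n, m (Nat.nthRoot e n), L (Nat.nthRoot e n), H (Nat.nthRoot e n)⟩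

theorem eventually_admissible
    (hm : (fun N => (m N : ℝ)) =O[atTop] fun N : ℕ => Real.log N)
    (hcm : ∀ᶠ N : ℕ in atTop, ((4 * c * (2 * k + 2) + 2 : ℕ) : ℝ) * Real.logb 2 N ≤ m N)
    (hpos : ∀ᶠ N : ℕ in atTop, 1 ≤ L N ∧ 1 ≤ H N)
    (hL : (fun N => (L N : ℝ)) =O[atTop] fun N : ℕ => (N : ℝ) ^ k)
    (hH : (fun N => (H N : ℝ)) =O[atTop] fun N : ℕ => (N : ℝ) ^ k) :
    ∀ᶠ n : ℕ in atTop,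
      Admissible (2 * k + 2) (paramsFor (2 * k + 2) m L H n (c * Nat.clog 2 n)) := by
  have he : 2 * k + 2 ≠ 0 := by omega
  have hroot := tendsto_nthRoot_atTop he
  filter_upwards [hroot.eventually (eventually_ge_atTop 2), hroot.eventually hcm,
    hroot.eventually hpos, hroot.eventually (eventually_mul_le_pow hL hH),
    hroot.eventually (eventually_pow_mul_exp_neg_le (2 * k + 2)),
    hroot.eventually (eventually_le_self hm)] with n hN hcm ⟨hL, hH⟩ hLH hexp hmN
  have hle := Nat.pow_nthRoot_le_iff.2 (.inl he : 2 * k + 2 ≠ 0 ∨ n ≠ 0)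
  have hlt := Nat.lt_pow_nthRoot_add_one he n
  refine ⟨hN, hL, hH, two_mul_dim_add_two_le hN hlt hcm, hmN, hle, hlt, ?_, ?_⟩
  · exact (hLH.trans (Nat.pow_le_pow_right (Nat.zero_lt_of_lt hN) (by omega))).trans hle
  · simp only [paramsFor]
    set N := Nat.nthRoot (2 * k + 2) n
    calc (L N : ℝ) * H N * (N * Real.exp (-N))
        ≤ (N : ℝ) ^ (2 * k + 1) * (N * Real.exp (-N)) := by
          gcongr
          exact_mod_cast hLH
      _ = (N : ℝ) ^ (2 * k + 2) * Real.exp (-N) := by ring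
      _ ≤ 1 / 10 := hexp

theorem floor_mul_le (K : ℝ) {x : ℝ} (hx : 0 ≤ x) : (⌊K * x⌋₊ : ℝ) ≤ |K| * x :=
  calc (⌊K * x⌋₊ : ℝ) ≤ ⌊|K| * x⌋₊ := by gcongr; exact le_abs_self K
    _ ≤ |K| * x := Nat.floor_le (by positivity)

theorem Admissible.reduction {e : ℕ} {π : Params} {Pparam P : Prog} {K₁ K₂ : ℝ}
    (h : Admissible e π) (hke : k ≤ e) (hδ : δ ≤ 1) (hδε : δ ≤ ε) (hb : 1 ≤ b)
    (hparam : RunsWithin Pparam (paramInput π.N) (K₁ * (π.N : ℝ) ^ k) fun s =>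
      s outArray 0 = π.m ∧ s outArray 1 = π.L ∧ s outArray 2 = π.H)
    (hP : ∀ (W : Weights π.m π.L π.H) (X : Matrix (Fin π.N) (Fin π.m) ℚ),
      W.Bounded (π.N ^ b) → (∀ i j, RatBounded (π.N ^ b) (X i j)) →
        RunsWithin P (transformerInput W X) (K₂ * ((π.L : ℝ) * π.H * (π.N : ℝ) ^ (2 - ε)))
          (OutputsApprox (W.transformer.eval (X.map (fun r : ℚ => (r : ℝ)))) (1 / (10 * π.N))))
    (A B C : Fin π.n → Fin π.d → Bool) :
    RunsWithin (OVReduction.reduction e Pparam P) (ovInput A B C)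
      ((OVReduction.reduction e Pparam P).weight * 104 * (2 + |K₁| + 64 * (3 + |K₂|)) *
        (π.n.size * ((π.m : ℝ) ^ 2 * ((π.n : ℝ) ^ 3 * (π.N : ℝ) ^ (-δ)))))
      fun s => s outArray 0 ≠ 0 ↔ ∃ i j k, OrthogonalTriple (A i) (B j) (C k) := by
  have hsucceeds := succeeds_of_computes (inp := ovInput A B C)
    (fun a ha ha' => ovInput_le_one A B C ha ha') h.two_le_N hb h.dim_le h.error_le
      fun W X hW hX => (hP W X hW hX).floor
  have hruns := (h.fits A B C).reduction h.n_pos h.two_le_N (Nat.mul_pos h.L_pos h.H_pos)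
    h.dim_le h.pow_le h.lt_pow hparam.floor hsucceeds
  have htime := h.time_le hke hδ hδε (abs_nonneg K₁) (abs_nonneg K₂)
    (floor_mul_le K₁ (by positivity)) (floor_mul_le K₂ (by positivity))
  refine RunsWithin.mono hruns ?_ fun _ => id
  push_cast at htime ⊢
  calc _ = _ := by ring
    _ ≤ _ := mul_le_mul_of_nonneg_left htime
      (by positivity : (0 : ℝ) ≤ (OVReduction.reduction e Pparam P).weight * (104 * π.n.size))
    _ = _ := by ring

theorem solvesThreeOV_reduction {Pparam P : Prog} {K₁ : ℝ} (hδ : 0 < δ) (hδ' : δ ≤ 1)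
    (hδε : δ ≤ ε) (hm : (fun N => (m N : ℝ)) =O[atTop] fun N : ℕ => Real.log N)
    (hcm : ∀ᶠ N : ℕ in atTop, ((4 * c * (2 * k + 2) + 2 : ℕ) : ℝ) * Real.logb 2 N ≤ m N)
    (hpos : ∀ᶠ N : ℕ in atTop, 1 ≤ L N ∧ 1 ≤ H N)
    (hL : (fun N => (L N : ℝ)) =O[atTop] fun N : ℕ => (N : ℝ) ^ k)
    (hH : (fun N => (H N : ℝ)) =O[atTop] fun N : ℕ => (N : ℝ) ^ k)
    (hparam : ∀ᶠ N : ℕ in atTop, RunsWithin Pparam (paramInput N) (K₁ * (N : ℝ) ^ k) fun s =>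
      s outArray 0 = m N ∧ s outArray 1 = L N ∧ s outArray 2 = H N)
    (hb : 1 ≤ b)
    (hP : ComputesTransformers P m L H b fun N => (L N : ℝ) * H N * (N : ℝ) ^ (2 - ε)) :
    SolvesThreeOV (reduction (2 * k + 2) Pparam P) (fun n => c * Nat.clog 2 n)
      fun n => (n : ℝ) ^ (3 - δ / (2 * (2 * k + 2 : ℕ))) := by
  obtain ⟨K₂, hP⟩ := hP
  have he : 2 * k + 2 ≠ 0 := by omega
  have hroot := tendsto_nthRoot_atTop he
  obtain ⟨K₃, hK₃⟩ := (time_isBigO hm he hδ hδ').bound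
  refine ⟨(reduction (2 * k + 2) Pparam P).weight * 104 * (2 + |K₁| + 64 * (3 + |K₂|)) * K₃, ?_⟩
  filter_upwards [eventually_admissible hm hcm hpos hL hH, hroot.eventually hparam,
    hroot.eventually hP, hK₃] with n hadm hparam hP hK₃ A B C
  rw [Real.norm_of_nonneg (by positivity), Real.norm_of_nonneg (by positivity)] at hK₃
  refine (hadm.reduction (k := k) (by omega) hδ' hδε hb hparam hP A B C).mono ?_ fun _ => id
  rw [mul_assoc _ K₃]
  exact mul_le_mul_of_nonneg_left hK₃ (by positivity)

end Main

end OVReduction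

theorem mainTheorem2 (hOV : ThreeOVHypothesis) (ε : ℝ) (hε : 0 < ε) (k : ℕ) :
    ∃ c : ℕ, ∀ m L H : ℕ → ℕ,
      (fun N => (m N : ℝ)) =Θ[atTop] (fun N : ℕ => Real.log N) →
      (∀ᶠ N : ℕ in atTop, (c : ℝ) * Real.logb 2 N ≤ m N) →
      (∀ᶠ N : ℕ in atTop, 1 ≤ L N ∧ 1 ≤ H N) →
      (fun N => (L N : ℝ)) =O[atTop] (fun N : ℕ => (N : ℝ) ^ k) →
      (fun N => (H N : ℝ)) =O[atTop] (fun N : ℕ => (N : ℝ) ^ k) →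
      ComputableParams m L H (fun N => (N : ℝ) ^ k) →
      ∀ b : ℕ, 1 ≤ b →
        ¬ ∃ P : Prog, ComputesTransformers P m L H b
          (fun N => (L N : ℝ) * (H N : ℝ) * (N : ℝ) ^ (2 - ε)) := by
  have hδ : 0 < min ε 1 := lt_min hε one_pos
  obtain ⟨c, hc⟩ := hOV (min ε 1 / (2 * (2 * k + 2 : ℕ))) (by positivity)
  refine ⟨4 * c * (2 * k + 2) + 2, fun m L H hm hcm hpos hL hH hparam b hb ⟨P, hP⟩ => hc ?_⟩
  obtain ⟨Pparam, K₁, hparam⟩ := hparam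
  exact ⟨_, OVReduction.solvesThreeOV_reduction hδ (min_le_right _ _) (min_le_left _ _) hm.1 hcm
    hpos hL hH hparam hb hP⟩
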